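/- **Theorem (Algebraic convergence of the best $s$-term approximation).** Let $\mathcal U=[-1,1]^{\mathbb N}$ with the uniform (product) probability measure $\varrho$. Let $\mathcal F$ be the set of multi-indices $\bm\nu\in\mathbb N_0^{\mathbb N}$ with finitely many nonzero entries and, for $\bm\nu\in\mathcal F$, let $\Psi_{\bm\nu}(\bm y)=\prod_{i:\nu_i\ne 0}\sqrt{2\nu_i+1}\,P_{\nu_i}(y_i)$, where $P_n$ is the Legendre polynomial of degree $n$ with $P_n(1)=1$. Let $\mathcal V$ be a Banach space over $\mathbb R$, regarded as an isometrically embedded real subspace of a complex Banach space $\mathcal W$ (for instance a complexification of $\mathcal V$, or $\mathcal W=\mathcal V$ if $\mathcal V$ is complex). For $\rho\ge 1$ let $\mathcal E(\rho)=\{(z+z^{-1})/2: z\in\mathbb C,\ 1\le|z|\le\rho\}$, and for $\bm b\in[0,\infty)^{\mathbb N}$ let $$\mathcal R(\bm b,1)=\bigcup\Big\{\mathcal E(\rho_1)\times\mathcal E(\rho_2)\times\cdots:\ \rho_j\ge 1\ \ \forall j,\ \ \sum_{j=1}^\infty\Big(\frac{\rho_j+\rho_j^{-1}}2-1\Big)b_j\le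 1\Big\}\subset\mathbb C^{\mathbb N}.$$ Let $\mathcal H(\bm b)$ be the class of all (strongly $\varrho$-measurable) $f:\mathcal U\to\mathcal V$ for which there are a set $\mathcal O\supseteq\mathcal R(\bm b,1)$ that is open in $\mathbb C^{\mathbb N}$ (for the box topology, hence in particular any set open for the product topology) and an extension $\tilde f:\mathcal O\to\mathcal W$ of $f$ that is complex differentiable in each variable at each point of $\mathcal O$ and satisfies $\|\tilde f(\bm z)\|_{\mathcal W}\le 1$ for all $\bm z\in\mathcal R(\bm b,1)$. The Legendre coefficients of $f$ are $\bm c=(c_{\bm\nu})_{\bm\nu\in\mathcal F}$, $c_{\bm\nu}=\int_{\mathcal U}f\,\Psi_{\bm\nu}\,d\varrho\in\mathcal V$. For $S\subset\mathcal F$, $\bm c_S$ is the sequence that agrees with $\bm c$ on $S$ and vanishes off $S$, and $f_S=\sum_{\bm\nu\in S}c_{\bm\nu}\Psi_{\bm\nu}$. Write $\|\bm c\|_{q;\mathcal V}=\big(\sum_{\bm\nu\in\mathcal F}\|c_{\bm\nu}\|_{\mathcal V}^q\big)^{1/q}$ and $\sigma_s(\bm c)_{q;\mathcal V}=\inf\{\|\bm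 c-\bm z\|_{q;\mathcal V}:\bm z\in\ell^q(\mathcal F;\mathcal V),\ |\mathrm{supp}(\bm z)|\le s\}$. Let $\bm b\in[0,\infty)^{\mathbb N}$ with $\bm b\in\ell^p(\mathbb N)$ for some $0<p<1$. Then there is a constant $C=C(\bm b,p)>0$, depending only on $\bm b$ and $p$, with the following properties. 1. For every integer $s\ge 1$ and every $p\le q\le 2$ there is a set $S\subset\mathcal F$ with $|S|\le s$, independent of $\mathcal V$, $\mathcal W$ and $f$, such that for all $f\in\mathcal H(\bm b)$ with Legendre coefficients $\bm c$ $$\sigma_s(\bm c)_{q;\mathcal V}\le\|\bm c-\bm c_S\|_{q;\mathcal V}\le C\, s^{\frac1q-\frac1p}.$$ 2. For every integer $s\ge 1$ there is a set $S\subset\mathcal F$ with $|S|\le s$, independent of $\mathcal V$, $\mathcal W$ and $f$, such that, whenever $\mathcal V$ is a Hilbert space, for all $f\in\mathcal H(\bm b)$ $$\inf_{T\subset\mathcal F,\ |T|=s}\|f-f_T\|_{L^2_\varrho(\mathcal U;\mathcal V)}\le\|f-f_S\|_{L^2_\varrho(\mathcal U;\mathcal V)}\le C\, s^{\frac12-\frac1p}.$$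 -/

import Mathlib

open MeasureTheory Filter Topology
open scoped ENNReal

namespace HoloApprox

noncomputable section

/-- The parameter domain `[-1,1]^ℕ`. -/
abbrev Dom : Type := ℕ → Set.Icc (-1 : ℝ) 1

/-- The uniform probability measure on `[-1,1]`. -/
def unif : Measure (Set.Icc (-1 : ℝ) 1) :=
  (2 : ℝ≥0∞)⁻¹ • Measure.comap Subtype.val (volume : Measure ℝ)

instance : IsProbabilityMeasure unif := by
  constructor
  have h : Measure.comap (Subtype.val : Set.Icc (-1 : ℝ) 1 → ℝ) volume Set.univ = 2 := by
    rw [comap_subtype_coe_apply measurableSet_Icc, Set.image_univ, Subtype.range_coe,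
      Real.volume_Icc]
    norm_num
  simp only [unif, Measure.smul_apply, h, smul_eq_mul]
  exact ENNReal.inv_mul_cancel (by norm_num) (by norm_num)

/-- The uniform (infinite product) probability measure on `[-1,1]^ℕ`. -/
def unifDom : Measure Dom := Measure.infinitePi (fun _ : ℕ => unif)

/-! ### Legendre polynomials and Legendre coefficients -/

/-- The Legendre polynomial of degree `n`, normalized by `P_n(1) = 1` (Rodrigues' formula). -/
def legendreP (n : ℕ) : Polynomial ℝ :=
  Polynomial.C ((2 ^ n * (n.factorial : ℝ))⁻¹) *
    (Polynomial.derivative^[n] ((Polynomial.X ^ 2 - 1) ^ n))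

/-- The univariate Legendre polynomials, orthonormal for the uniform probability measure. -/
def psi (n : ℕ) (t : ℝ) : ℝ := Real.sqrt (2 * (n : ℝ) + 1) * (legendreP n).eval t

/-- The tensor product Legendre polynomials, indexed by the finitely supported multi-indices. -/
def Psi (ν : ℕ →₀ ℕ) (y : Dom) : ℝ := ∏ i ∈ ν.support, psi (ν i) (y i)

section Coefficients

variable {V : Type*} [NormedAddCommGroup V] [NormedSpace ℝ V]

/-- The Legendre coefficients `c_ν = ∫ f Ψ_ν` (Bochner integrals). -/
def coeff (f : Dom → V) (ν : ℕ →₀ ℕ) : V := ∫ y, Psi ν y • f y ∂unifDom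

/-- The truncated expansion `f_S = ∑_{ν ∈ S} c_ν Ψ_ν`. -/
def partialSum (f : Dom → V) (S : Finset (ℕ →₀ ℕ)) (y : Dom) : V :=
  ∑ ν ∈ S, Psi ν y • coeff f ν

/-- The error of best `s`-term polynomial approximation of `f` in the `L²` norm: the infimum of
`‖f - f_S‖` over all index sets `S` of size `s`. -/
def bestL2Error (s : ℕ) (f : Dom → V) : ℝ≥0∞ :=
  ⨅ S ∈ {S : Finset (ℕ →₀ ℕ) | S.card = s},
    eLpNorm (fun y => f y - partialSum f S y) 2 unifDom

end Coefficients

/-! ### Sequence norms -/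

section Sequences

variable {I V : Type*} [NormedAddCommGroup V]

/-- The `ℓ^q` (quasi-)norm of a `V`-valued family, for `0 < q < ∞`. It is `∞` exactly for the
families that are not in `ℓ^q`. -/
def ellNorm (q : ℝ) (c : I → V) : ℝ≥0∞ := (∑' i, ‖c i‖ₑ ^ q) ^ (1 / q)

/-- The restriction `c_S` of a family to an index set, extended by zero. -/
def restr (c : I → V) (S : Finset I) : I → V := Set.indicator (S : Set I) c

/-- The `ℓ^q`-norm best `s`-term approximation error of a family. -/
def bestTermError (s : ℕ) (q : ℝ) (c : I → V) : ℝ≥0∞ :=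
  ⨅ z ∈ {z : I → V | ellNorm q z < ∞ ∧ (Function.support z).encard ≤ s},
    ellNorm q (c - z)

end Sequences

/-! ### Holomorphic functions of infinitely many variables -/

/-- The filled Bernstein ellipse with parameter `ρ ≥ 1`; it is `[-1,1]` for `ρ = 1`. -/
def ellipse (ρ : ℝ) : Set ℂ := {w | ∃ z : ℂ, 1 ≤ ‖z‖ ∧ ‖z‖ ≤ ρ ∧ w = (z + z⁻¹) / 2}

/-- The Bernstein polyellipse with parameter `ρ = (ρ_j)`. -/
def polyellipse (ρ : ℕ → ℝ) : Set (ℕ → ℂ) := {z | ∀ j, z j ∈ ellipse (ρ j)}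

/-- The region `R(b, ε)`, a union of Bernstein polyellipses. -/
def region (b : ℕ → ℝ) (ε : ℝ) : Set (ℕ → ℂ) :=
  {z | ∃ ρ : ℕ → ℝ, (∀ j, 1 ≤ ρ j) ∧
    Summable (fun j => ((ρ j + (ρ j)⁻¹) / 2 - 1) * b j) ∧
    ∑' j, ((ρ j + (ρ j)⁻¹) / 2 - 1) * b j ≤ ε ∧ z ∈ polyellipse ρ}

/-- Openness in `ℂ^ℕ`: with each point, the set contains a product of discs about it (of radii
that may depend on the coordinate). Every set that is open for the product topology, or for
uniform convergence, is open in this sense, so that the class of functions with a holomorphic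
extension is the largest for this choice. -/
def IsBoxOpen (O : Set (ℕ → ℂ)) : Prop :=
  ∀ z ∈ O, ∃ r : ℕ → ℝ, (∀ j, 0 < r j) ∧ ∀ w : ℕ → ℂ, (∀ j, ‖w j - z j‖ < r j) → w ∈ O

/-- Holomorphy in an open set: complex differentiability in each variable at each point, that is,
existence of `lim_{h → 0} (g (z + h e_j) - g z) / h`. The values of `g` off the open set `O` do not
matter. -/
def HolomorphicIn {W : Type*} [NormedAddCommGroup W] [NormedSpace ℂ W]
    (O : Set (ℕ → ℂ)) (g : (ℕ → ℂ) → W) : Prop :=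
  ∀ z ∈ O, ∀ j : ℕ, DifferentiableAt ℂ (fun ζ : ℂ => g (Function.update z j ζ)) (z j)

/-- The class `H(b)` of `(b,1)`-holomorphic functions `f : [-1,1]^ℕ → V` of norm at most one:
`f` extends to a holomorphic function on an open set that contains `R(b,1)`, and the
extension is bounded by one on `R(b,1)`. The complex derivatives of the extension need complex
scalars, so the extension takes values in a complex Banach space `W` that contains the real Banach
space `V` isometrically through `ι`: a complexification of `V`, or `V` itself when `V` is complex
and `ι` is the identity. -/
def holoClass {V W : Type*} [NormedAddCommGroup V] [NormedSpace ℝ V]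
    [NormedAddCommGroup W] [NormedSpace ℂ W] (ι : V →ₗᵢ[ℝ] W) (b : ℕ → ℝ) : Set (Dom → V) :=
  {f | ∃ (O : Set (ℕ → ℂ)) (g : (ℕ → ℂ) → W), IsBoxOpen O ∧ region b 1 ⊆ O ∧
    HolomorphicIn O g ∧
    (∀ y : Dom, g (fun j => (((y j : ℝ) : ℂ))) = ι (f y)) ∧
    ∀ z ∈ region b 1, ‖g z‖ ≤ 1}

end

end HoloApprox

/-! Moving the contour in one variable after the other from `[-1, 1]` to the Bernstein ellipse of
radius `ρ_j` gives `‖c_ν‖ ≤ ∏_{ν_j ≠ 0} 2 ρ_j / (ρ_j - 1) ρ_j ^ (-ν_j)` for every admissible `ρ`.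
Only the finitely many variables with `ν_j ≠ 0` are involved, so joint holomorphy is never needed.
After `b` is enlarged so that all `b_j > 0`, the radii are adapted to `ν`: a constant `κ > 1` in
finitely many head coordinates and `κ + ν_j / (|ν_tail| b_j)` in the others, which keeps the
polyellipse inside `R(b, 1)` and gives a bound `B ν` with a multinomial tail factor. If the head is
large enough, `B` is `p`-summable. The `s` largest values of `B` make up the set `S`, and Stechkin's
inequality bounds the error in `ℓ^q`. The `L²` bound is the case `q = 2`, because the products of
Legendre polynomials form a complete orthonormal system, so that Parseval's identity holds in a
Hilbert space. -/

namespace HoloApprox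

noncomputable section

/-! ### Legendre polynomials -/

section Legendre

open Polynomial

lemma integral_eval_derivative_mul (p q : ℝ[X]) (a b : ℝ) :
    ∫ x in a..b, (derivative p * q).eval x =
      (p * q).eval b - (p * q).eval a - ∫ x in a..b, (p * derivative q).eval x := by
  have hp := (derivative p * q).continuous.intervalIntegrable (μ := volume) a b
  have hq := (p * derivative q).continuous.intervalIntegrable (μ := volume) a b
  have ftc : ∫ x in a..b, (derivative (p * q)).eval x = (p * q).eval b - (p * q).eval a :=
    intervalIntegral.integral_eq_sub_of_hasDerivAt (fun x _ => (p * q).hasDerivAt x)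
      ((derivative (p * q)).continuous.intervalIntegrable _ _)
  simp only [derivative_mul, eval_add] at ftc
  rw [intervalIntegral.integral_add hp hq] at ftc
  linarith

lemma integral_eval_iterate_derivative_mul (p q : ℝ[X]) {a b : ℝ} {n : ℕ}
    (ha : ∀ k < n, (derivative^[k] p).eval a = 0) (hb : ∀ k < n, (derivative^[k] p).eval b = 0) :
    ∫ x in a..b, (derivative^[n] p * q).eval x =
      (-1) ^ n * ∫ x in a..b, (p * derivative^[n] q).eval x := by
  induction n generalizing q with
  | zero => simp
  | succ n ih =>
    rw [Function.iterate_succ_apply', integral_eval_derivative_mul, eval_mul, eval_mul,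
      ha n n.lt_succ_self, hb n n.lt_succ_self,
      ih _ (fun k hk => ha k (hk.trans n.lt_succ_self))
        (fun k hk => hb k (hk.trans n.lt_succ_self)),
      Function.iterate_succ_apply]
    ring

lemma eval_iterate_derivative_pow_eq_zero {R : Type*} [CommRing R] {p : R[X]} {a : R}
    (hp : p.eval a = 0) {k n : ℕ} (hk : k < n) : (derivative^[k] (p ^ n)).eval a = 0 := by
  obtain ⟨r, hr⟩ := pow_sub_dvd_iterate_derivative_pow p n k
  rw [hr, eval_mul, eval_pow, hp, zero_pow (Nat.sub_ne_zero_of_lt hk), zero_mul]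

lemma degree_X_mul_derivative_sub_lt {R : Type*} [CommRing R] {p : R[X]} {n : ℕ}
    (hp : p.degree ≤ n) : (X * derivative p - C (n : R) * p).degree < (n : WithBot ℕ) := by
  rw [degree_lt_iff_coeff_zero]
  intro m hm
  rw [coeff_sub, coeff_C_mul]
  rcases m with _ | m
  · simp [show n = 0 by omega]
  rw [coeff_X_mul, coeff_derivative]
  rcases hm.eq_or_lt with rfl | h
  · push_cast; ring
  · rw [coeff_eq_zero_of_degree_lt (hp.trans_lt (by exact_mod_cast h))]; ring

lemma integral_legendreP_mul_of_degree_lt (n : ℕ) {q : ℝ[X]} (hq : q.degree < n) :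
    ∫ x in (-1 : ℝ)..1, (legendreP n * q).eval x = 0 := by
  have hderiv : derivative^[n] q = 0 :=
    iterate_derivative_eq_zero_of_degree_lt hq
  simp only [legendreP, mul_assoc (C _), eval_C_mul, intervalIntegral.integral_const_mul]
  rw [integral_eval_iterate_derivative_mul _ _
      (fun k hk => eval_iterate_derivative_pow_eq_zero (by simp) hk)
      (fun k hk => eval_iterate_derivative_pow_eq_zero (by simp) hk), hderiv]
  simp

lemma eval_legendreP_of_sq_eq_one (n : ℕ) {a : ℝ} (ha : a ^ 2 = 1) :
    (legendreP n).eval a = a ^ n := by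
  have htaylor : taylor a (X ^ 2 - 1 : ℝ[X]) = X * (X + C (2 * a)) := by
    have hC : (C a : ℝ[X]) ^ 2 = 1 := by rw [← C_pow, ha, C_1]
    simp only [map_sub, taylor_pow, taylor_X, taylor_one, map_mul, C_1, C_ofNat]
    linear_combination hC
  have hderiv : (derivative^[n] ((X ^ 2 - 1 : ℝ[X]) ^ n)).eval a = n.factorial * (2 * a) ^ n := by
    rw [← factorial_smul_hasseDeriv, LinearMap.smul_apply, eval_smul, nsmul_eq_mul,
      ← taylor_coeff, taylor_pow, htaylor, mul_pow, coeff_X_pow_mul', if_pos le_rfl, Nat.sub_self,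
      coeff_zero_eq_eval_zero]
    simp
  have := Nat.factorial_ne_zero n
  rw [legendreP, eval_mul, eval_C, hderiv, mul_pow]
  field_simp

lemma degree_legendreP_le (n : ℕ) : (legendreP n).degree ≤ n := by
  have hdeg : ((X ^ 2 - 1 : ℝ[X]) ^ n).natDegree ≤ n * 2 :=
    natDegree_pow_le.trans (Nat.mul_le_mul_left _ (by compute_degree))
  have hderiv := natDegree_iterate_derivative ((X ^ 2 - 1 : ℝ[X]) ^ n) n
  exact degree_le_of_natDegree_le ((natDegree_C_mul_le _ _).trans (by omega))

lemma integral_legendreP_mul_self (n : ℕ) :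
    ∫ x in (-1 : ℝ)..1, (legendreP n * legendreP n).eval x = 2 / (2 * n + 1) := by
  set P := legendreP n
  set q := X * derivative P - C (n : ℝ) * P
  have horth : ∫ x in (-1 : ℝ)..1, (P * q).eval x = 0 :=
    integral_legendreP_mul_of_degree_lt n (degree_X_mul_derivative_sub_lt (degree_legendreP_le n))
  have hsplit : ∫ x in (-1 : ℝ)..1, (derivative (P * P) * X).eval x =
      2 * n * ∫ x in (-1 : ℝ)..1, (P * P).eval x := by
    have heq : ∀ x, (derivative (P * P) * X).eval x =
        2 * (P * q).eval x + 2 * n * (P * P).eval x := fun x => by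
      simp only [q, derivative_mul, eval_mul, eval_add, eval_sub, eval_X, eval_C]; ring
    have hint (r : ℝ[X]) : IntervalIntegrable (fun x => r.eval x) volume (-1) 1 :=
      r.continuous.intervalIntegrable _ _
    simp only [heq]
    rw [intervalIntegral.integral_add ((hint _).const_mul _) ((hint _).const_mul _),
      intervalIntegral.integral_const_mul, intervalIntegral.integral_const_mul, horth]
    ring
  have hparts := integral_eval_derivative_mul (P * P) X (-1) 1
  have hone : P.eval 1 = 1 := by
    rw [eval_legendreP_of_sq_eq_one n (by norm_num), one_pow]
  have hneg : P.eval (-1) * P.eval (-1) = 1 := by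
    rw [eval_legendreP_of_sq_eq_one n (by norm_num), ← mul_pow]; norm_num
  rw [hsplit] at hparts
  simp only [derivative_X, mul_one, eval_mul, eval_X, hone, hneg] at hparts ⊢
  rw [eq_div_iff (by positivity)]
  linarith

lemma degree_legendreP (n : ℕ) : (legendreP n).degree = n := by
  refine le_antisymm (degree_legendreP_le n) (not_lt.1 fun hlt => ?_)
  have hself := integral_legendreP_mul_self n
  rw [integral_legendreP_mul_of_degree_lt n hlt] at hself
  exact (by positivity : (2 : ℝ) / (2 * n + 1) ≠ 0) hself.symm

/-- The Legendre polynomials as a sequence with one polynomial of each degree. -/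
def legendreSeq : Polynomial.Sequence ℝ := ⟨legendreP, degree_legendreP⟩

lemma span_range_legendreP : Submodule.span ℝ (Set.range legendreP) = ⊤ :=
  legendreSeq.span fun i => (leadingCoeff_ne_zero.2 (legendreSeq.ne_zero i)).isUnit

lemma psi_zero (t : ℝ) : psi 0 t = 1 := by simp [psi, legendreP]

@[fun_prop]
lemma continuous_psi (n : ℕ) : Continuous (psi n) :=
  continuous_const.mul (legendreP n).continuous

lemma exists_eval_eq_sum_psi (q : ℝ[X]) :
    ∃ (N : Finset ℕ) (a : ℕ → ℝ), ∀ t : ℝ, q.eval t = ∑ k ∈ N, a k * psi k t := by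
  have hq : q ∈ Submodule.span ℝ (Set.range legendreP) := span_range_legendreP ▸ trivial
  obtain ⟨c, rfl⟩ := Finsupp.mem_span_range_iff_exists_finsupp.1 hq
  refine ⟨c.support, fun k => c k / √(2 * (k : ℝ) + 1), fun t => ?_⟩
  rw [Finsupp.sum, eval_finsetSum]
  refine Finset.sum_congr rfl fun k _ => ?_
  have : √(2 * (k : ℝ) + 1) ≠ 0 := (Real.sqrt_pos.2 (by positivity)).ne'
  rw [eval_smul, smul_eq_mul, psi]
  field_simp

end Legendre

section Uniform

lemma integral_unif {E : Type*} [NormedAddCommGroup E] [NormedSpace ℝ E] (g : ℝ → E) :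
    ∫ y, g y ∂unif = (2 : ℝ)⁻¹ • ∫ x in (-1 : ℝ)..1, g x := by
  rw [unif, integral_smul_measure, integral_subtype_comap measurableSet_Icc g,
    integral_Icc_eq_integral_Ioc, intervalIntegral.integral_of_le (by norm_num)]
  simp

lemma integrable_unif_of_continuous {E : Type*} [NormedAddCommGroup E]
    {g : Set.Icc (-1 : ℝ) 1 → E} (hg : Continuous g) : Integrable g unif :=
  hg.integrable_of_hasCompactSupport (HasCompactSupport.of_compactSpace _)

lemma integral_psi_mul_eval_of_degree_lt (n : ℕ) {q : Polynomial ℝ} (hq : q.degree < n) :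
    ∫ y : Set.Icc (-1 : ℝ) 1, psi n y * q.eval (y : ℝ) ∂unif = 0 := by
  rw [integral_unif (fun y => psi n y * q.eval y)]
  simp only [psi, mul_assoc, intervalIntegral.integral_const_mul, ← Polynomial.eval_mul,
    integral_legendreP_mul_of_degree_lt n hq, mul_zero, smul_zero]

lemma integral_psi_mul_psi_of_lt {m n : ℕ} (h : m < n) :
    ∫ y : Set.Icc (-1 : ℝ) 1, psi n y * psi m y ∂unif = 0 := by
  have hdeg : (Polynomial.C √(2 * (m : ℝ) + 1) * legendreP m).degree < n := by
    rw [Polynomial.degree_C_mul (Real.sqrt_pos.2 (by positivity)).ne', degree_legendreP]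
    exact_mod_cast h
  simpa only [psi, Polynomial.eval_C_mul] using integral_psi_mul_eval_of_degree_lt n hdeg

lemma integral_psi_mul_self (n : ℕ) :
    ∫ y : Set.Icc (-1 : ℝ) 1, psi n y * psi n y ∂unif = 1 := by
  have hsq (x : ℝ) : psi n x * psi n x = (2 * n + 1) * (legendreP n * legendreP n).eval x := by
    have := Real.mul_self_sqrt (by positivity : (0 : ℝ) ≤ 2 * n + 1)
    rw [← this, psi, Polynomial.eval_mul]; ring
  rw [integral_unif (fun y => psi n y * psi n y)]
  simp only [hsq, intervalIntegral.integral_const_mul, integral_legendreP_mul_self, smul_eq_mul]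
  field_simp

lemma integral_psi_mul_psi (n m : ℕ) :
    ∫ y : Set.Icc (-1 : ℝ) 1, psi n y * psi m y ∂unif = if n = m then 1 else 0 := by
  rcases lt_trichotomy n m with h | rfl | h
  · simpa only [mul_comm, if_neg h.ne] using integral_psi_mul_psi_of_lt h
  · rw [if_pos rfl, integral_psi_mul_self]
  · rw [if_neg h.ne', integral_psi_mul_psi_of_lt h]

lemma integral_abs_psi_le_one (n : ℕ) :
    ∫ y : Set.Icc (-1 : ℝ) 1, |psi n y| ∂unif ≤ 1 := by
  have hsq : Integrable (fun y : Set.Icc (-1 : ℝ) 1 => psi n y * psi n y) unif :=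
    integrable_unif_of_continuous (by fun_prop)
  calc ∫ y : Set.Icc (-1 : ℝ) 1, |psi n y| ∂unif
      ≤ ∫ y : Set.Icc (-1 : ℝ) 1, (psi n y * psi n y + 1) / 2 ∂unif := by
        refine integral_mono (integrable_unif_of_continuous (by fun_prop))
          ((hsq.add (integrable_const _)).div_const _) fun y => ?_
        dsimp only
        nlinarith only [sq_nonneg (|psi n y| - 1), sq_abs (psi n y)]
    _ = 1 := by
        rw [integral_div, integral_add hsq (integrable_const _), integral_psi_mul_self]
        simp

end Uniform

/-! ### The Cauchy formula on a Bernstein ellipse -/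

section Joukowski

/-- The Joukowski map, which takes the circles of radii `ρ` and `ρ⁻¹` to the boundary of
`ellipse ρ`. -/
def joukowski (w : ℂ) : ℂ := (w + w⁻¹) / 2

/-- The Cauchy kernel `J'(w) w / (J(w) - t)` of a Bernstein ellipse, pulled back along the Joukowski
map `J` and normalized for averages over circles. -/
def joukowskiKernel (t w : ℂ) : ℂ := (w ^ 2 - 1) / (w ^ 2 - 2 * t * w + 1)

lemma joukowski_inv (w : ℂ) : joukowski w⁻¹ = joukowski w := by
  simp only [joukowski, inv_inv, add_comm]

lemma joukowski_mem_ellipse {ρ : ℝ} {w : ℂ} (h1 : 1 ≤ ‖w‖) (h2 : ‖w‖ ≤ ρ) :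
    joukowski w ∈ ellipse ρ :=
  ⟨w, h1, h2, rfl⟩

lemma differentiableAt_joukowski {w : ℂ} (hw : w ≠ 0) : DifferentiableAt ℂ joukowski w :=
  (differentiableAt_id.add (differentiableAt_inv hw)).div_const 2

lemma exists_norm_eq_one_joukowski_eq {t : ℝ} (ht : t ∈ Set.Icc (-1 : ℝ) 1) :
    ∃ z : ℂ, ‖z‖ = 1 ∧ joukowski z = t := by
  refine ⟨Complex.exp (Real.arccos t * Complex.I), Complex.norm_exp_ofReal_mul_I _, ?_⟩
  rw [joukowski, ← Complex.exp_neg, ← neg_mul, ← Complex.cos, ← Complex.ofReal_cos,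
    Real.cos_arccos ht.1 ht.2]

lemma ofReal_mem_ellipse {ρ : ℝ} (hρ : 1 ≤ ρ) {t : ℝ} (ht : t ∈ Set.Icc (-1 : ℝ) 1) :
    (t : ℂ) ∈ ellipse ρ := by
  obtain ⟨z, hz, hzt⟩ := exists_norm_eq_one_joukowski_eq ht
  exact hzt ▸ joukowski_mem_ellipse hz.ge (hz.le.trans hρ)

lemma two_mul_eval_T_joukowski {z : ℂ} (hz : z ≠ 0) (n : ℕ) :
    2 * (Polynomial.Chebyshev.T ℂ n).eval (joukowski z) = z ^ n + z⁻¹ ^ n := by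
  have hcosh : joukowski z = Complex.cosh (Complex.log z) := by
    rw [joukowski, Complex.cosh, Complex.exp_neg, Complex.exp_log hz]
  rw [hcosh, Polynomial.Chebyshev.T_complex_cosh, Complex.cosh, Int.cast_natCast, ← mul_neg,
    Complex.exp_nat_mul, Complex.exp_nat_mul, Complex.exp_neg, Complex.exp_log hz]
  ring

lemma sq_sub_two_mul_joukowski {z : ℂ} (hz : z ≠ 0) (w : ℂ) :
    w ^ 2 - 2 * joukowski z * w + 1 = (w - z) * (w - z⁻¹) := by
  simp only [joukowski]; field_simp; ring

lemma two_mul_joukowski_sub {w : ℂ} (hw : w ≠ 0) (t : ℂ) :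
    2 * w * (joukowski w - t) = w ^ 2 - 2 * t * w + 1 := by
  simp only [joukowski]; field_simp; ring

lemma sub_ne_zero_of_norm_lt {E : Type*} [SeminormedAddCommGroup E] {z w : E} (h : ‖z‖ < ‖w‖) :
    w - z ≠ 0 :=
  sub_ne_zero.2 fun e => h.ne' (congrArg norm e)

lemma sq_sub_two_mul_add_one_ne_zero {t : ℝ} (ht : t ∈ Set.Icc (-1 : ℝ) 1) {w : ℂ}
    (hw : 1 < ‖w‖) : w ^ 2 - 2 * (t : ℂ) * w + 1 ≠ 0 := by
  obtain ⟨z, hz, hzt⟩ := exists_norm_eq_one_joukowski_eq ht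
  have hz0 : z ≠ 0 := norm_pos_iff.1 (hz ▸ one_pos)
  rw [← hzt, sq_sub_two_mul_joukowski hz0]
  exact mul_ne_zero (sub_ne_zero_of_norm_lt (by rwa [hz]))
    (sub_ne_zero_of_norm_lt (by rwa [norm_inv, hz, inv_one]))

lemma joukowski_ne_ofReal {t : ℝ} (ht : t ∈ Set.Icc (-1 : ℝ) 1) {w : ℂ} (hw : 1 < ‖w‖) :
    joukowski w ≠ t := by
  intro e
  refine sq_sub_two_mul_add_one_ne_zero ht hw ?_
  rw [← two_mul_joukowski_sub (norm_pos_iff.1 (one_pos.trans hw)), e, sub_self, mul_zero]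

lemma joukowskiKernel_joukowski {z w : ℂ} (hz : ‖z‖ = 1) (hw : 1 < ‖w‖) :
    joukowskiKernel (joukowski z) w = w / (w - z) + w / (w - z⁻¹) - 1 := by
  have hz0 : z ≠ 0 := norm_pos_iff.1 (hz ▸ one_pos)
  have h1 : w - z ≠ 0 := sub_ne_zero_of_norm_lt (by rwa [hz])
  have h2 : w - z⁻¹ ≠ 0 := sub_ne_zero_of_norm_lt (by rwa [norm_inv, hz, inv_one])
  have h3 : z * z⁻¹ = 1 := mul_inv_cancel₀ hz0
  rw [joukowskiKernel, sq_sub_two_mul_joukowski hz0, div_add_div _ _ h1 h2,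
    div_sub_one (mul_ne_zero h1 h2)]
  congr 1
  linear_combination h3

lemma norm_circleMap_zero_of_pos {ρ : ℝ} (hρ : 0 < ρ) (θ : ℝ) : ‖circleMap 0 ρ θ‖ = ρ := by
  rw [norm_circleMap_zero, abs_of_pos hρ]

lemma joukowski_circleMap_mem_ellipse {ρ : ℝ} (hρ : 1 ≤ ρ) (θ : ℝ) :
    joukowski (circleMap 0 ρ θ) ∈ ellipse ρ := by
  have h := norm_circleMap_zero_of_pos (one_pos.trans_le hρ) θ
  exact joukowski_mem_ellipse (hρ.trans h.ge) h.le

lemma continuous_joukowski_circleMap {ρ : ℝ} (hρ : ρ ≠ 0) :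
    Continuous fun θ => joukowski (circleMap 0 ρ θ) :=
  continuous_iff_continuousAt.2 fun _ =>
    (differentiableAt_joukowski (circleMap_ne_center hρ)).continuousAt.comp
      (continuous_circleMap 0 ρ).continuousAt

lemma continuous_joukowskiKernel_circleMap {ρ : ℝ} (hρ : 1 < ρ) :
    Continuous fun x : Set.Icc (-1 : ℝ) 1 × ℝ =>
      joukowskiKernel ((x.1 : ℝ) : ℂ) (circleMap 0 ρ x.2) := by
  refine Continuous.div (by fun_prop) (by fun_prop) fun x =>
    sq_sub_two_mul_add_one_ne_zero x.1.2 ?_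
  rwa [norm_circleMap_zero_of_pos (one_pos.trans hρ)]

end Joukowski

section Cauchy

variable {W : Type*} [NormedAddCommGroup W] [NormedSpace ℂ W]

lemma circleAverage_eq_of_differentiableOn_annulus {r R : ℝ} (hr : 0 < r) (hrR : r ≤ R) {c : ℂ}
    {f : ℂ → W} (hc : ContinuousOn f (Metric.closedBall c R \ Metric.ball c r))
    (hd : ∀ z ∈ Metric.ball c R \ Metric.closedBall c r, DifferentiableAt ℂ f z) :
    Real.circleAverage f c R = Real.circleAverage f c r := by
  rw [Real.circleAverage_eq_circleIntegral hr.ne',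
    Real.circleAverage_eq_circleIntegral (hr.trans_le hrR).ne',
    Complex.circleIntegral_sub_center_inv_smul_eq_of_differentiable_on_annulus_off_countable
      hr hrR Set.countable_empty hc fun z hz => hd z hz.1]

lemma circleAverage_zero_one_eq_zero_of_inv {f : ℂ → W} (hf : ∀ w, f w⁻¹ = -f w) :
    Real.circleAverage f 0 1 = 0 := by
  have h := Real.circleAverage_zero_one_congr_inv (f := f)
  simp only [hf, Real.circleAverage, intervalIntegral.integral_neg, smul_neg] at h
  rw [neg_eq_iff_add_eq_zero, ← two_smul ℂ] at h
  exact (smul_eq_zero.1 h).resolve_left two_ne_zero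

lemma circleAverage_joukowskiKernel {ρ : ℝ} (hρ : 1 < ρ) {t : ℝ} (ht : t ∈ Set.Icc (-1 : ℝ) 1) :
    Real.circleAverage (joukowskiKernel t) 0 ρ = 1 := by
  obtain ⟨z, hz, hzt⟩ := exists_norm_eq_one_joukowski_eq ht
  have hsphere {w : ℂ} (hw : w ∈ Metric.sphere (0 : ℂ) |ρ|) : 1 < ‖w‖ := by
    rwa [mem_sphere_zero_iff_norm.1 hw, abs_of_pos (one_pos.trans hρ)]
  have havg {u : ℂ} (hu : ‖u‖ = 1) : Real.circleAverage (fun w => w / (w - u)) 0 ρ = 1 := by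
    simpa using (diffContOnCl_const (c := (1 : ℂ))).circleAverage_smul_div (c := 0) (R := ρ)
      (w := u) (by simpa [hu] using hρ.trans_le (le_abs_self ρ))
  have hint {u : ℂ} (hu : ‖u‖ = 1) : CircleIntegrable (fun w => w / (w - u)) 0 ρ :=
    ContinuousOn.circleIntegrable' <| continuousOn_id.div (continuousOn_id.sub continuousOn_const)
      fun w hw => sub_ne_zero_of_norm_lt (hu ▸ hsphere hw)
  have hz' : ‖z⁻¹‖ = 1 := by rw [norm_inv, hz, inv_one]
  have hadd : CircleIntegrable (fun w => w / (w - z) + w / (w - z⁻¹)) 0 ρ :=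
    (hint hz).add (hint hz')
  rw [Real.circleAverage_congr_sphere
      (f₂ := fun w => w / (w - z) + w / (w - z⁻¹) - 1)
      fun w hw => hzt ▸ joukowskiKernel_joukowski hz (hsphere hw),
    Real.circleAverage_fun_sub hadd (circleIntegrable_const _ _ _),
    Real.circleAverage_fun_add (hint hz) (hint hz'), havg hz, havg hz', Real.circleAverage_const]
  norm_num

lemma circleAverage_dslope_joukowski {ρ : ℝ} (hρ : 1 ≤ ρ) {F : ℂ → W}
    (hF : ∀ ζ ∈ ellipse ρ, DifferentiableAt ℂ F ζ) {t : ℝ} (ht : t ∈ Set.Icc (-1 : ℝ) 1) :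
    Real.circleAverage (fun w => ((w ^ 2 - 1) / (2 * w)) • dslope F t (joukowski w)) 0 ρ = 0 := by
  have hquot {w : ℂ} (hw : w ≠ 0) : DifferentiableAt ℂ (fun w : ℂ => (w ^ 2 - 1) / (2 * w)) w :=
    DifferentiableAt.div (by fun_prop) (by fun_prop) (by simpa using hw)
  rw [circleAverage_eq_of_differentiableOn_annulus one_pos hρ]
  · refine circleAverage_zero_one_eq_zero_of_inv fun w => ?_
    rw [joukowski_inv, ← neg_smul]
    congr 1
    rcases eq_or_ne w 0 with rfl | hw
    · simp
    · field_simp; ring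
  · rintro w ⟨hwρ, hw1⟩
    rw [mem_closedBall_zero_iff] at hwρ
    rw [mem_ball_zero_iff, not_lt] at hw1
    have hw0 : w ≠ 0 := norm_pos_iff.1 (one_pos.trans_le hw1)
    refine ((hquot hw0).continuousAt.smul (ContinuousAt.comp (g := dslope F t) ?_
      (differentiableAt_joukowski hw0).continuousAt)).continuousWithinAt
    by_cases h : joukowski w = t
    · rw [h]; exact continuousAt_dslope_same.2 (hF t (ofReal_mem_ellipse hρ ht))
    · exact (continuousAt_dslope_of_ne h).2 (hF _ (joukowski_mem_ellipse hw1 hwρ)).continuousAt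
  · rintro w ⟨hwρ, hw1⟩
    rw [mem_ball_zero_iff] at hwρ
    rw [mem_closedBall_zero_iff, not_le] at hw1
    have hw0 : w ≠ 0 := norm_pos_iff.1 (one_pos.trans hw1)
    exact (hquot hw0).smul (DifferentiableAt.comp (g := dslope F t) w
      ((differentiableAt_dslope_of_ne (joukowski_ne_ofReal ht hw1)).2
        (hF _ (joukowski_mem_ellipse hw1.le hwρ.le))) (differentiableAt_joukowski hw0))

lemma continuous_comp_joukowski_circleMap {ρ : ℝ} (hρ : 1 ≤ ρ) {F : ℂ → W}
    (hF : ∀ ζ ∈ ellipse ρ, DifferentiableAt ℂ F ζ) :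
    Continuous fun θ => F (joukowski (circleMap 0 ρ θ)) :=
  continuous_iff_continuousAt.2 fun θ =>
    (hF _ (joukowski_circleMap_mem_ellipse hρ θ)).continuousAt.comp
      (f := fun θ => joukowski (circleMap 0 ρ θ))
      (continuous_joukowski_circleMap (one_pos.trans_le hρ).ne').continuousAt

theorem circleAverage_joukowskiKernel_smul [CompleteSpace W] {ρ : ℝ} (hρ : 1 < ρ) {F : ℂ → W}
    (hF : ∀ ζ ∈ ellipse ρ, DifferentiableAt ℂ F ζ) {t : ℝ} (ht : t ∈ Set.Icc (-1 : ℝ) 1) :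
    Real.circleAverage (fun w => joukowskiKernel t w • F (joukowski w)) 0 ρ = F t := by
  have hker : Continuous fun θ => joukowskiKernel t (circleMap 0 ρ θ) :=
    (continuous_joukowskiKernel_circleMap hρ).comp
      (f := fun θ : ℝ => ((⟨t, ht⟩ : Set.Icc (-1 : ℝ) 1), θ)) (by fun_prop)
  have hkerF : CircleIntegrable (fun w => joukowskiKernel t w • F (joukowski w)) 0 ρ :=
    (hker.smul (continuous_comp_joukowski_circleMap hρ.le hF)).intervalIntegrable _ _
  have hkert : CircleIntegrable (fun w => joukowskiKernel t w • F t) 0 ρ :=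
    (hker.smul continuous_const).intervalIntegrable _ _
  have hconst : Real.circleAverage (fun w => joukowskiKernel t w • F t) 0 ρ = F t := by
    have h := circleAverage_joukowskiKernel hρ ht
    rw [Real.circleAverage] at h ⊢
    rw [intervalIntegral.integral_smul_const, ← smul_assoc, h, one_smul]
  have hzero := circleAverage_dslope_joukowski hρ.le hF ht
  rw [Real.circleAverage_congr_sphere (f₂ := fun w => joukowskiKernel t w • F (joukowski w) -
    joukowskiKernel t w • F t), Real.circleAverage_fun_sub hkerF hkert, hconst, sub_eq_zero]
    at hzero
  · exact hzero
  intro w hw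
  have hw1 : 1 < ‖w‖ := by
    rwa [mem_sphere_zero_iff_norm.1 hw, abs_of_pos (one_pos.trans hρ)]
  have hw0 : w ≠ 0 := norm_pos_iff.1 (one_pos.trans hw1)
  have hJ := sub_ne_zero.2 (joukowski_ne_ofReal ht hw1)
  simp only [← smul_sub]
  rw [← sub_smul_dslope, smul_smul, joukowskiKernel, ← two_mul_joukowski_sub hw0]
  congr 1
  field_simp

end Cauchy

section LegendreKernel

/-- The partial sum of the Chebyshev expansion of `joukowskiKernel · w`. -/
def chebyshevPartialSum (n : ℕ) (w : ℂ) : Polynomial ℂ :=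
  ∑ k ∈ Finset.range n, (2 * w⁻¹ ^ k) • Polynomial.Chebyshev.T ℂ k - 1

lemma degree_chebyshevPartialSum_lt {n : ℕ} (hn : n ≠ 0) (w : ℂ) :
    (chebyshevPartialSum n w).degree < n := by
  refine (Polynomial.degree_sub_le _ _).trans_lt (max_lt ?_ ?_)
  · refine (Polynomial.degree_sum_le _ _).trans_lt
      ((Finset.sup_lt_iff (WithBot.bot_lt_coe n)).2 fun k hk => ?_)
    refine (Polynomial.degree_smul_le _ _).trans_lt ?_
    rw [Polynomial.Chebyshev.degree_T, Int.natAbs_natCast]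
    exact WithBot.coe_lt_coe.2 (Finset.mem_range.1 hk)
  · rw [Polynomial.degree_one]
    exact_mod_cast Nat.pos_of_ne_zero hn

lemma eval_chebyshevPartialSum_joukowski (n : ℕ) (w : ℂ) {z : ℂ} (hz : z ≠ 0) :
    (chebyshevPartialSum n w).eval (joukowski z) =
      ∑ k ∈ Finset.range n, (z / w) ^ k + ∑ k ∈ Finset.range n, (z⁻¹ / w) ^ k - 1 := by
  rw [chebyshevPartialSum, Polynomial.eval_sub, Polynomial.eval_finsetSum, Polynomial.eval_one,
    ← Finset.sum_add_distrib]
  congr 1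
  refine Finset.sum_congr rfl fun k _ => ?_
  rw [Polynomial.eval_smul, smul_eq_mul, mul_right_comm, two_mul_eval_T_joukowski hz,
    add_mul, div_eq_mul_inv, div_eq_mul_inv, mul_pow, mul_pow]

lemma norm_div_sub_sub_geom_sum_le {ρ : ℝ} (hρ : 1 < ρ) {z w : ℂ} (hz : ‖z‖ = 1) (hw : ‖w‖ = ρ)
    (n : ℕ) :
    ‖w / (w - z) - ∑ k ∈ Finset.range n, (z / w) ^ k‖ ≤ ρ / (ρ - 1) * (ρ ^ n)⁻¹ := by
  have hρ0 : 0 < ρ := one_pos.trans hρ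
  have hw0 : w ≠ 0 := norm_pos_iff.1 (hw ▸ hρ0)
  have hwz : w - z ≠ 0 := sub_ne_zero_of_norm_lt (by rwa [hz, hw])
  have hne : z / w ≠ 1 := fun h => hwz (sub_eq_zero.2 ((div_eq_one_iff_eq hw0).1 h).symm)
  have hrem : w / (w - z) - ∑ k ∈ Finset.range n, (z / w) ^ k =
      w / (w - z) * (z / w) ^ n := by
    have hsub : z / w - 1 = -((w - z) / w) := by field_simp; ring
    rw [geom_sum_eq hne, hsub]
    field_simp
    ring
  have hdist : ρ - 1 ≤ ‖w - z‖ := by simpa only [hz, hw] using norm_sub_norm_le w z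
  rw [hrem, norm_mul, norm_pow, norm_div, norm_div, hz, hw, one_div, inv_pow]
  have := sub_pos.2 hρ
  gcongr

lemma norm_joukowskiKernel_sub_le {ρ : ℝ} (hρ : 1 < ρ) {w : ℂ} (hw : ‖w‖ = ρ) {t : ℝ}
    (ht : t ∈ Set.Icc (-1 : ℝ) 1) (n : ℕ) :
    ‖joukowskiKernel t w - (chebyshevPartialSum n w).eval (t : ℂ)‖ ≤
      2 * ρ / (ρ - 1) * (ρ ^ n)⁻¹ := by
  obtain ⟨z, hz, hzt⟩ := exists_norm_eq_one_joukowski_eq ht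
  have hz0 : z ≠ 0 := norm_pos_iff.1 (hz ▸ one_pos)
  have hz' : ‖z⁻¹‖ = 1 := by rw [norm_inv, hz, inv_one]
  rw [← hzt, joukowskiKernel_joukowski hz (hw ▸ hρ), eval_chebyshevPartialSum_joukowski n w hz0,
    sub_sub_sub_cancel_right, add_sub_add_comm]
  calc _ ≤ ρ / (ρ - 1) * (ρ ^ n)⁻¹ + ρ / (ρ - 1) * (ρ ^ n)⁻¹ :=
        norm_add_le_of_le (norm_div_sub_sub_geom_sum_le hρ hz hw n)
          (norm_div_sub_sub_geom_sum_le hρ hz' hw n)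
    _ = _ := by ring

lemma integral_psi_mul_complex_eval_of_degree_lt (n : ℕ) {q : Polynomial ℂ} (hq : q.degree < n) :
    ∫ t : Set.Icc (-1 : ℝ) 1, (psi n t : ℂ) * q.eval ((t : ℝ) : ℂ) ∂unif = 0 := by
  have hmonomial {k : ℕ} (hk : k < n) :
      ∫ t : Set.Icc (-1 : ℝ) 1, (psi n t : ℂ) * ((t : ℝ) : ℂ) ^ k ∂unif = 0 := by
    have h := integral_psi_mul_eval_of_degree_lt n (q := Polynomial.X ^ k)
      (by rw [Polynomial.degree_X_pow]; exact_mod_cast hk)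
    simp only [Polynomial.eval_pow, Polynomial.eval_X] at h
    simpa only [Complex.ofReal_mul, Complex.ofReal_pow, h, Complex.ofReal_zero] using
      integral_complex_ofReal (μ := unif) (f := fun t => psi n t * (t : ℝ) ^ k)
  have hexp (t : ℝ) : (psi n t : ℂ) * q.eval (t : ℂ) =
      ∑ k ∈ q.support, q.coeff k * ((psi n t : ℂ) * (t : ℂ) ^ k) := by
    rw [Polynomial.eval_eq_sum, Polynomial.sum, Finset.mul_sum]
    exact Finset.sum_congr rfl fun k _ => mul_left_comm _ _ _
  simp only [hexp]
  rw [integral_finsetSum _ fun k _ => integrable_unif_of_continuous (by fun_prop)]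
  refine Finset.sum_eq_zero fun k hk => ?_
  rw [integral_const_mul, hmonomial, mul_zero]
  exact_mod_cast (Polynomial.le_degree_of_mem_supp k hk).trans_lt hq

/-- The weight that turns a Legendre coefficient into an average over the boundary of a Bernstein
ellipse; `w` is the Joukowski coordinate of the boundary point. -/
def legendreKernel (n : ℕ) (w : ℂ) : ℂ :=
  ∫ t : Set.Icc (-1 : ℝ) 1, (psi n t : ℂ) * joukowskiKernel ((t : ℝ) : ℂ) w ∂unif

/-- The factor by which integration against `psi n` is smaller than the supremum over
`ellipse ρ`. -/
def ellipseFactor (n : ℕ) (ρ : ℝ) : ℝ := if n = 0 then 1 else 2 * ρ / (ρ - 1) * (ρ ^ n)⁻¹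

lemma ellipseFactor_zero (ρ : ℝ) : ellipseFactor 0 ρ = 1 := if_pos rfl

lemma ellipseFactor_nonneg {n : ℕ} {ρ : ℝ} (hρ : 1 ≤ ρ) : 0 ≤ ellipseFactor n ρ := by
  have := sub_nonneg.2 hρ
  rw [ellipseFactor]
  split_ifs <;> positivity

lemma continuous_psi_mul_joukowskiKernel_circleMap (n : ℕ) {ρ : ℝ} (hρ : 1 < ρ) :
    Continuous fun x : Set.Icc (-1 : ℝ) 1 × ℝ =>
      (psi n x.1 : ℂ) * joukowskiKernel ((x.1 : ℝ) : ℂ) (circleMap 0 ρ x.2) :=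
  Continuous.mul (by fun_prop) (continuous_joukowskiKernel_circleMap hρ)

lemma measurable_legendreKernel_circleMap (n : ℕ) {ρ : ℝ} (hρ : 1 < ρ) :
    Measurable fun θ => legendreKernel n (circleMap 0 ρ θ) :=
  (continuous_psi_mul_joukowskiKernel_circleMap n
    hρ).stronglyMeasurable.integral_prod_left'.measurable

-- Orthogonality allows subtracting the Chebyshev partial sum from the kernel.
lemma norm_legendreKernel_circleMap_le {n : ℕ} (hn : n ≠ 0) {ρ : ℝ} (hρ : 1 < ρ) (θ : ℝ) :
    ‖legendreKernel n (circleMap 0 ρ θ)‖ ≤ ellipseFactor n ρ := by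
  have hw := norm_circleMap_zero_of_pos (one_pos.trans hρ) θ
  have hker : Continuous fun t : Set.Icc (-1 : ℝ) 1 =>
      (psi n t : ℂ) * joukowskiKernel ((t : ℝ) : ℂ) (circleMap 0 ρ θ) :=
    (continuous_psi_mul_joukowskiKernel_circleMap n hρ).comp
      (f := fun t : Set.Icc (-1 : ℝ) 1 => (t, θ)) (by fun_prop)
  generalize circleMap 0 ρ θ = w at hw hker
  have hsub : legendreKernel n w = ∫ t : Set.Icc (-1 : ℝ) 1, (psi n t : ℂ) *
      (joukowskiKernel ((t : ℝ) : ℂ) w - (chebyshevPartialSum n w).eval ((t : ℝ) : ℂ)) ∂unif := by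
    simp only [mul_sub]
    rw [integral_sub (integrable_unif_of_continuous hker)
      (integrable_unif_of_continuous (by fun_prop)),
      integral_psi_mul_complex_eval_of_degree_lt n (degree_chebyshevPartialSum_lt hn w), sub_zero,
      legendreKernel]
  rw [hsub]
  calc _ ≤ ∫ t : Set.Icc (-1 : ℝ) 1, |psi n t| * ellipseFactor n ρ ∂unif := by
        refine norm_integral_le_of_norm_le (integrable_unif_of_continuous (by fun_prop))
          (ae_of_all _ fun t => ?_)
        rw [norm_mul, Complex.norm_real, Real.norm_eq_abs, ellipseFactor, if_neg hn]
        exact mul_le_mul_of_nonneg_left (norm_joukowskiKernel_sub_le hρ hw t.2 n) (abs_nonneg _)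
    _ ≤ ellipseFactor n ρ := by
        rw [integral_mul_const]
        exact mul_le_of_le_one_left (ellipseFactor_nonneg hρ.le) (integral_abs_psi_le_one n)

/-- The uniform probability measure on the interval `(0, 2π]`. -/
def angleMeasure : Measure ℝ := ProbabilityTheory.cond volume (Set.Ioc 0 (2 * Real.pi))

instance : IsProbabilityMeasure angleMeasure :=
  ProbabilityTheory.cond_isProbabilityMeasure_of_finite (by simp [Real.pi_pos])
    measure_Ioc_lt_top.ne

lemma integral_angleMeasure_circleMap {E : Type*} [NormedAddCommGroup E] [NormedSpace ℝ E]
    (g : ℂ → E) (ρ : ℝ) :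
    ∫ θ, g (circleMap 0 ρ θ) ∂angleMeasure = Real.circleAverage g 0 ρ := by
  have hπ : 0 ≤ 2 * Real.pi := by positivity
  rw [angleMeasure, ProbabilityTheory.cond, integral_smul_measure, Real.circleAverage,
    intervalIntegral.integral_of_le hπ, Real.volume_Ioc, sub_zero, ENNReal.toReal_inv,
    ENNReal.toReal_ofReal hπ]

lemma integrable_unif_prod_angleMeasure_of_continuous {E : Type*} [NormedAddCommGroup E]
    {g : Set.Icc (-1 : ℝ) 1 × ℝ → E} (hg : Continuous g) :
    Integrable g (unif.prod angleMeasure) := by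
  have hI : IntegrableOn g (Set.univ ×ˢ Set.Ioc 0 (2 * Real.pi)) (unif.prod volume) :=
    (hg.continuousOn.integrableOn_compact (isCompact_univ.prod isCompact_Icc)).mono_set
      (Set.prod_mono_right Set.Ioc_subset_Icc_self)
  rw [IntegrableOn, ← Measure.prod_restrict, Measure.restrict_univ] at hI
  rw [angleMeasure, ProbabilityTheory.cond, Measure.prod_smul_right]
  exact hI.smul_measure (by simp [Real.pi_pos])

theorem integral_psi_smul_eq_integral_legendreKernel_smul {W : Type*} [NormedAddCommGroup W]
    [NormedSpace ℂ W] [CompleteSpace W] (n : ℕ) {ρ : ℝ} (hρ : 1 < ρ) {F : ℂ → W}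
    (hF : ∀ ζ ∈ ellipse ρ, DifferentiableAt ℂ F ζ) :
    ∫ t : Set.Icc (-1 : ℝ) 1, (psi n t : ℂ) • F ((t : ℝ) : ℂ) ∂unif =
      ∫ θ, legendreKernel n (circleMap 0 ρ θ) • F (joukowski (circleMap 0 ρ θ)) ∂angleMeasure := by
  have hcauchy (t : Set.Icc (-1 : ℝ) 1) : (psi n t : ℂ) • F ((t : ℝ) : ℂ) =
      ∫ θ, ((psi n t : ℂ) * joukowskiKernel ((t : ℝ) : ℂ) (circleMap 0 ρ θ)) •
        F (joukowski (circleMap 0 ρ θ)) ∂angleMeasure := by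
    simp only [mul_smul]
    rw [integral_smul, integral_angleMeasure_circleMap
      (fun w => joukowskiKernel ((t : ℝ) : ℂ) w • F (joukowski w)),
      circleAverage_joukowskiKernel_smul hρ hF t.2]
  have hcont : Continuous (Function.uncurry fun (t : Set.Icc (-1 : ℝ) 1) (θ : ℝ) =>
      ((psi n t : ℂ) * joukowskiKernel ((t : ℝ) : ℂ) (circleMap 0 ρ θ)) •
        F (joukowski (circleMap 0 ρ θ))) :=
    (continuous_psi_mul_joukowskiKernel_circleMap n hρ).smul
      ((continuous_comp_joukowski_circleMap hρ.le hF).comp continuous_snd)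
  simp only [hcauchy, legendreKernel]
  rw [integral_integral_swap (integrable_unif_prod_angleMeasure_of_continuous hcont)]
  simp only [integral_smul_const]

end LegendreKernel

/-! ### Separately holomorphic functions of finitely many variables -/

section Fubini

lemma measurePreserving_cons {X : Type*} [MeasurableSpace X] (μ : Measure X) [SigmaFinite μ]
    (m : ℕ) :
    MeasurePreserving (fun x : X × (Fin m → X) => (Fin.cons x.1 x.2 : Fin (m + 1) → X))
      (μ.prod (Measure.pi fun _ => μ)) (Measure.pi fun _ => μ) := by
  convert (measurePreserving_piFinSuccAbove (fun _ : Fin (m + 1) => μ) 0).symm using 1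
  ext x : 1
  exact (Fin.insertNth_zero' x.1 x.2).symm

lemma stronglyMeasurable_of_separately_continuous {X E : Type*} [TopologicalSpace X]
    [TopologicalSpace.MetrizableSpace X] [MeasurableSpace X] [SecondCountableTopology X]
    [OpensMeasurableSpace X] [TopologicalSpace E] [TopologicalSpace.PseudoMetrizableSpace E] {m : ℕ}
    {φ : (Fin m → X) → E} (h : ∀ x j, Continuous fun s => φ (Function.update x j s)) :
    StronglyMeasurable φ := by
  induction m with
  | zero => exact stronglyMeasurable_const' fun x y => by rw [Subsingleton.elim x y]
  | succ m ih =>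
    have hcons : StronglyMeasurable
        (Function.uncurry fun (s : X) (x : Fin m → X) => φ (Fin.cons s x)) := by
      refine stronglyMeasurable_uncurry_of_continuous_of_stronglyMeasurable (fun x => ?_)
        fun s => ih fun x j => ?_
      · exact continuous_iff_continuousAt.2 fun s => by
          simpa only [Fin.update_cons_zero] using (h (Fin.cons s x) 0).continuousAt (x := s)
      · simpa only [Fin.cons_update] using h (Fin.cons s x) j.succ
    have htail : Measurable fun x : Fin (m + 1) → X => (x 0, Fin.tail x) :=
      (measurable_pi_apply 0).prodMk (measurable_pi_iff.2 fun j => measurable_pi_apply _)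
    simpa only [Function.comp_def, Function.uncurry, Fin.cons_self_tail] using
      hcons.comp_measurable htail

lemma norm_smul_le_mul_of_le {W : Type*} [NormedAddCommGroup W] [NormedSpace ℂ W] {c : ℂ} {x : W}
    {C M : ℝ} (hc : ‖c‖ ≤ C) (hx : ‖x‖ ≤ M) : ‖c • x‖ ≤ C * M :=
  (norm_smul c x).trans_le (mul_le_mul hc hx (norm_nonneg _) ((norm_nonneg _).trans hc))

lemma norm_integral_smul_integral_smul_le {Ω X W : Type*} [MeasurableSpace Ω] [MeasurableSpace X]
    [NormedAddCommGroup W] [NormedSpace ℂ W] {μ : Measure Ω} [IsProbabilityMeasure μ]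
    {ν : Measure X} [SFinite ν] {k : Ω → ℂ} {w : X → ℂ} {φ : Ω → X → W} {K B : ℝ}
    (hint : Integrable (fun z : Ω × X => w z.2 • k z.1 • φ z.1 z.2) (μ.prod ν))
    (hk : ∀ ω, ‖k ω‖ ≤ K) (hB : ∀ ω, ‖∫ x, w x • φ ω x ∂ν‖ ≤ B) :
    ‖∫ x, w x • ∫ ω, k ω • φ ω x ∂μ ∂ν‖ ≤ K * B := by
  simp only [← integral_smul]
  rw [← integral_integral_swap hint]
  simp only [smul_comm (w _) (k _), integral_smul]
  simpa using norm_integral_le_of_norm_le_const (μ := μ) <| ae_of_all _ fun ω =>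
    norm_smul_le_mul_of_le (hk ω) (hB ω)

end Fubini

section SeparatelyHolomorphic

variable {W : Type*} [NormedAddCommGroup W] [NormedSpace ℂ W] {m : ℕ}

/-- Holomorphy in each variable at each point of a product of sets in `ℂ`. -/
def SeparatelyHolomorphic (E : Fin m → Set ℂ) (h : (Fin m → ℂ) → W) : Prop :=
  ∀ z, (∀ i, z i ∈ E i) → ∀ j, DifferentiableAt ℂ (fun ζ => h (Function.update z j ζ)) (z j)

namespace SeparatelyHolomorphic

lemma tail {E : Fin (m + 1) → Set ℂ} {h : (Fin (m + 1) → ℂ) → W} (hh : SeparatelyHolomorphic E h)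
    {ζ : ℂ} (hζ : ζ ∈ E 0) :
    SeparatelyHolomorphic (fun i => E i.succ) fun z => h (Fin.cons ζ z) := by
  intro z hz j
  simpa only [Fin.cons_update, Fin.cons_succ] using hh (Fin.cons ζ z) (Fin.cases hζ hz) j.succ

lemma differentiableAt_cons {E : Fin (m + 1) → Set ℂ} {h : (Fin (m + 1) → ℂ) → W}
    (hh : SeparatelyHolomorphic E h) {z : Fin m → ℂ} (hz : ∀ i, z i ∈ E i.succ) {ζ : ℂ}
    (hζ : ζ ∈ E 0) : DifferentiableAt ℂ (fun ζ => h (Fin.cons ζ z)) ζ := by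
  simpa only [Fin.update_cons_zero, Fin.cons_zero] using
    hh (Fin.cons ζ z) (Fin.cases hζ hz) 0

lemma stronglyMeasurable_comp {X : Type*} [TopologicalSpace X]
    [TopologicalSpace.MetrizableSpace X] [MeasurableSpace X] [SecondCountableTopology X]
    [OpensMeasurableSpace X] {E : Fin m → Set ℂ} {h : (Fin m → ℂ) → W}
    (hh : SeparatelyHolomorphic E h) {γ : X → ℂ} (hγ : Continuous γ) (hE : ∀ i x, γ x ∈ E i) :
    StronglyMeasurable fun x : Fin m → X => h fun i => γ (x i) := by
  refine stronglyMeasurable_of_separately_continuous fun x j =>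
    continuous_iff_continuousAt.2 fun s => ?_
  have hd := hh (fun i => γ (Function.update x j s i)) (fun i => hE i _) j
  have hupd : (fun s' => h fun i => γ (Function.update x j s' i)) =
      (fun ζ => h (Function.update (fun i => γ (Function.update x j s i)) j ζ)) ∘ γ := by
    refine funext fun s' => congrArg h (funext fun i => ?_)
    rcases eq_or_ne i j with rfl | hij
    · simp only [Function.update_self]
    · simp only [Function.update_of_ne hij]
  rw [Function.update_self] at hd
  rw [hupd]
  exact hd.continuousAt.comp hγ.continuousAt

lemma integrable_smul_cons {Ω : Type*} [TopologicalSpace Ω] [TopologicalSpace.MetrizableSpace Ω]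
    [MeasurableSpace Ω] [SecondCountableTopology Ω] [OpensMeasurableSpace Ω]
    {E : Fin (m + 1) → Set ℂ} {h : (Fin (m + 1) → ℂ) → W} (hh : SeparatelyHolomorphic E h) {M : ℝ}
    (hM : ∀ z, (∀ i, z i ∈ E i) → ‖h z‖ ≤ M)
    (hE : ∀ i, ∀ t : Set.Icc (-1 : ℝ) 1, ((t : ℝ) : ℂ) ∈ E i) {γ : Ω → ℂ} (hγ : Continuous γ)
    (hγE : ∀ ω, γ ω ∈ E 0) (μ : Measure Ω) [IsProbabilityMeasure μ] {k : Ω → ℂ}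
    (hk : Measurable k) {K : ℝ} (hkK : ∀ ω, ‖k ω‖ ≤ K)
    {w : (Fin m → Set.Icc (-1 : ℝ) 1) → ℂ} (hw : Continuous w) :
    Integrable (fun z : Ω × (Fin m → Set.Icc (-1 : ℝ) 1) =>
      w z.2 • k z.1 • h (Fin.cons (γ z.1) fun i => ((z.2 i : ℝ) : ℂ)))
      (μ.prod (Measure.pi fun _ => unif)) := by
  have hmeas : StronglyMeasurable (Function.uncurry fun (ω : Ω) (x : Fin m → Set.Icc (-1 : ℝ) 1) =>
      h (Fin.cons (γ ω) fun i => ((x i : ℝ) : ℂ))) := by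
    refine stronglyMeasurable_uncurry_of_continuous_of_stronglyMeasurable (fun x => ?_) fun ω =>
      (hh.tail (hγE ω)).stronglyMeasurable_comp (γ := fun t : Set.Icc (-1 : ℝ) 1 => ((t : ℝ) : ℂ))
        (by fun_prop) fun i t => hE i.succ t
    exact continuous_iff_continuousAt.2 fun ω => ContinuousAt.comp (f := γ)
      (hh.differentiableAt_cons (fun i => hE i.succ (x i)) (hγE ω)).continuousAt hγ.continuousAt
  obtain ⟨C, hC⟩ := isCompact_univ.exists_bound_of_continuousOn hw.continuousOn
  refine Integrable.of_bound (C := C * (K * M)) ?_ (ae_of_all _ fun z => ?_)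
  · exact ((hw.stronglyMeasurable.comp_measurable measurable_snd).smul
      ((hk.comp measurable_fst).stronglyMeasurable.smul hmeas)).aestronglyMeasurable
  · exact norm_smul_le_mul_of_le (hC _ trivial) (norm_smul_le_mul_of_le (hkK _)
      (hM _ (Fin.cases (hγE _) fun i => hE i.succ (z.2 i))))

lemma integral_prod_psi_smul_succ {E : Fin (m + 1) → Set ℂ}
    {h : (Fin (m + 1) → ℂ) → W} (hh : SeparatelyHolomorphic E h) {M : ℝ}
    (hM : ∀ z, (∀ i, z i ∈ E i) → ‖h z‖ ≤ M)
    (hE : ∀ i, ∀ t : Set.Icc (-1 : ℝ) 1, ((t : ℝ) : ℂ) ∈ E i) (n : Fin (m + 1) → ℕ) :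
    ∫ x : Fin (m + 1) → Set.Icc (-1 : ℝ) 1, (∏ i, (psi (n i) (x i) : ℂ)) •
        h (fun i => ((x i : ℝ) : ℂ)) ∂Measure.pi (fun _ => unif) =
      ∫ x : Fin m → Set.Icc (-1 : ℝ) 1, (∏ i, (psi (n i.succ) (x i) : ℂ)) •
        ∫ t : Set.Icc (-1 : ℝ) 1, (psi (n 0) t : ℂ) •
          h (Fin.cons ((t : ℝ) : ℂ) fun i => ((x i : ℝ) : ℂ)) ∂unif
        ∂Measure.pi (fun _ => unif) := by
  have hcons := measurePreserving_cons unif m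
  obtain ⟨K, hK⟩ := isCompact_univ.exists_bound_of_continuousOn
    (f := fun t : Set.Icc (-1 : ℝ) 1 => (psi (n 0) t : ℂ)) (by fun_prop)
  have hint := hh.integrable_smul_cons hM hE (γ := fun t : Set.Icc (-1 : ℝ) 1 => ((t : ℝ) : ℂ))
    (by fun_prop) (hE 0) unif (k := fun t => (psi (n 0) t : ℂ)) (by fun_prop)
    (fun t => hK t trivial) (w := fun x => ∏ i, (psi (n i.succ) (x i) : ℂ)) (by fun_prop)
  have hmeas : StronglyMeasurable fun x : Fin (m + 1) → Set.Icc (-1 : ℝ) 1 =>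
      (∏ i, (psi (n i) (x i) : ℂ)) • h (fun i => ((x i : ℝ) : ℂ)) :=
    Continuous.stronglyMeasurable (by fun_prop) |>.smul
      (hh.stronglyMeasurable_comp (γ := fun t : Set.Icc (-1 : ℝ) 1 => ((t : ℝ) : ℂ))
        (by fun_prop) hE)
  have hsplit (t : Set.Icc (-1 : ℝ) 1) (x : Fin m → Set.Icc (-1 : ℝ) 1) :
      (fun i => (((Fin.cons t x : Fin (m + 1) → Set.Icc (-1 : ℝ) 1) i : ℝ) : ℂ)) =
        Fin.cons ((t : ℝ) : ℂ) fun i => ((x i : ℝ) : ℂ) :=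
    funext (Fin.cases rfl fun _ => rfl)
  rw [← hcons.map_eq, integral_map hcons.measurable.aemeasurable hmeas.aestronglyMeasurable]
  simp only [Fin.prod_univ_succ, Fin.cons_zero, Fin.cons_succ, hsplit, mul_smul]
  simp only [smul_comm ((psi (n 0) _ : ℝ) : ℂ) (∏ _, _)]
  rw [integral_prod_symm _ hint]
  simp only [integral_smul]

lemma norm_integral_prod_psi_smul_succ_le {Ω : Type*} [TopologicalSpace Ω]
    [TopologicalSpace.MetrizableSpace Ω] [MeasurableSpace Ω] [SecondCountableTopology Ω]
    [OpensMeasurableSpace Ω] {E : Fin (m + 1) → Set ℂ} {h : (Fin (m + 1) → ℂ) → W}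
    (hh : SeparatelyHolomorphic E h) {M : ℝ} (hM : ∀ z, (∀ i, z i ∈ E i) → ‖h z‖ ≤ M)
    (hE : ∀ i, ∀ t : Set.Icc (-1 : ℝ) 1, ((t : ℝ) : ℂ) ∈ E i) {γ : Ω → ℂ} (hγ : Continuous γ)
    (hγE : ∀ ω, γ ω ∈ E 0) {μ : Measure Ω} [IsProbabilityMeasure μ] {k : Ω → ℂ} (hk : Measurable k)
    {K : ℝ} (hkK : ∀ ω, ‖k ω‖ ≤ K) {n : Fin (m + 1) → ℕ}
    (hrep : ∀ F : ℂ → W, (∀ ζ ∈ E 0, DifferentiableAt ℂ F ζ) →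
      ∫ t : Set.Icc (-1 : ℝ) 1, (psi (n 0) t : ℂ) • F ((t : ℝ) : ℂ) ∂unif =
        ∫ ω, k ω • F (γ ω) ∂μ) {B : ℝ}
    (hB : ∀ ζ ∈ E 0, ‖∫ x : Fin m → Set.Icc (-1 : ℝ) 1, (∏ i, (psi (n i.succ) (x i) : ℂ)) •
      h (Fin.cons ζ fun i => ((x i : ℝ) : ℂ)) ∂Measure.pi (fun _ => unif)‖ ≤ B) :
    ‖∫ x : Fin (m + 1) → Set.Icc (-1 : ℝ) 1, (∏ i, (psi (n i) (x i) : ℂ)) •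
      h (fun i => ((x i : ℝ) : ℂ)) ∂Measure.pi (fun _ => unif)‖ ≤ K * B := by
  rw [hh.integral_prod_psi_smul_succ hM hE]
  have hswap (x : Fin m → Set.Icc (-1 : ℝ) 1) := hrep _ fun ζ hζ =>
    hh.differentiableAt_cons (fun i => hE i.succ (x i)) hζ
  simp only [hswap]
  have hint := hh.integrable_smul_cons hM hE hγ hγE μ hk hkK
    (w := fun x => ∏ i, (psi (n i.succ) (x i) : ℂ)) (by fun_prop)
  exact norm_integral_smul_integral_smul_le
    (φ := fun ω (x : Fin m → Set.Icc (-1 : ℝ) 1) =>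
      h (Fin.cons (γ ω) fun i => ((x i : ℝ) : ℂ))) hint hkK fun ω => hB _ (hγE ω)

-- One variable at a time, the integral over `[-1, 1]` is moved to the boundary of the ellipse.
theorem norm_integral_prod_psi_smul_le [CompleteSpace W] {ρ : Fin m → ℝ} (hρ : ∀ i, 1 ≤ ρ i)
    {n : Fin m → ℕ} (hn : ∀ i, n i ≠ 0 → 1 < ρ i) {h : (Fin m → ℂ) → W}
    (hh : SeparatelyHolomorphic (fun i => ellipse (ρ i)) h) {M : ℝ}
    (hM : ∀ z, (∀ i, z i ∈ ellipse (ρ i)) → ‖h z‖ ≤ M) :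
    ‖∫ x : Fin m → Set.Icc (-1 : ℝ) 1, (∏ i, (psi (n i) (x i) : ℂ)) •
      h (fun i => ((x i : ℝ) : ℂ)) ∂Measure.pi (fun _ => unif)‖ ≤
        (∏ i, ellipseFactor (n i) (ρ i)) * M := by
  have hE (i : Fin m) (t : Set.Icc (-1 : ℝ) 1) : ((t : ℝ) : ℂ) ∈ ellipse (ρ i) :=
    ofReal_mem_ellipse (hρ i) t.2
  induction m with
  | zero =>
    simpa using norm_integral_le_of_norm_le_const (μ := Measure.pi fun _ : Fin 0 => unif)
      (ae_of_all _ fun x => hM _ fun i => hE i (x i))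
  | succ m ih =>
    rw [Fin.prod_univ_succ, mul_assoc]
    have htail (ζ : ℂ) (hζ : ζ ∈ ellipse (ρ 0)) := ih (fun i => hρ i.succ) (fun i => hn i.succ)
      (hh.tail hζ) (fun z hz => hM (Fin.cons ζ z) (Fin.cases hζ hz)) fun i => hE i.succ
    rcases eq_or_ne (n 0) 0 with h0 | h0
    · refine hh.norm_integral_prod_psi_smul_succ_le hM hE (Ω := Set.Icc (-1 : ℝ) 1) (μ := unif)
        (γ := fun t => ((t : ℝ) : ℂ)) (k := fun _ => 1) (by fun_prop) (hE 0) measurable_const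
        (fun _ => ?_) (fun F _ => ?_) htail
      · rw [norm_one, h0, ellipseFactor_zero]
      · simp only [h0, psi_zero, Complex.ofReal_one]
    · exact hh.norm_integral_prod_psi_smul_succ_le hM hE (μ := angleMeasure)
        (continuous_joukowski_circleMap (one_pos.trans (hn 0 h0)).ne')
        (joukowski_circleMap_mem_ellipse (hρ 0))
        (measurable_legendreKernel_circleMap (n 0) (hn 0 h0))
        (norm_legendreKernel_circleMap_le h0 (hn 0 h0))
        (fun F hF => integral_psi_smul_eq_integral_legendreKernel_smul (n 0) (hn 0 h0) hF) htail

end SeparatelyHolomorphic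

end SeparatelyHolomorphic

/-! ### The bound for the Legendre coefficients -/

section InfiniteProduct

variable {κ ι X : Type*} {e : κ → ι}

lemma extend_mem_pi_iff (he : Function.Injective e) {x : κ → X} {y : ι → X} {s : Set ι}
    {t : ι → Set X} :
    Function.extend e x y ∈ s.pi t ↔
      x ∈ (e ⁻¹' s).pi (fun k => t (e k)) ∧ y ∈ (s \ Set.range e).pi t := by
  refine ⟨fun h => ⟨fun k hk => ?_, fun i hi => ?_⟩, fun h i hi => ?_⟩
  · simpa only [he.extend_apply] using h (e k) hk
  · simpa only [Function.extend_apply' _ _ _ hi.2] using h i hi.1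
  · by_cases hr : i ∈ Set.range e
    · obtain ⟨k, rfl⟩ := hr
      simpa only [he.extend_apply] using h.1 k hi
    · simpa only [Function.extend_apply' _ _ _ hr] using h.2 i ⟨hi, hr⟩

variable [MeasurableSpace X]

lemma measurable_extend (he : Function.Injective e) :
    Measurable fun q : (κ → X) × (ι → X) => Function.extend e q.1 q.2 := by
  refine measurable_pi_iff.2 fun i => ?_
  by_cases hi : ∃ k, e k = i
  · obtain ⟨k, rfl⟩ := hi
    simp only [he.extend_apply]
    fun_prop
  · simp only [Function.extend_apply' _ _ _ hi]
    fun_prop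

lemma measurePreserving_extend (μ : Measure X) [IsProbabilityMeasure μ]
    (he : Function.Injective e) :
    MeasurePreserving (fun q : (κ → X) × (ι → X) => Function.extend e q.1 q.2)
      ((Measure.infinitePi fun _ => μ).prod (Measure.infinitePi fun _ => μ))
      (Measure.infinitePi fun _ => μ) := by
  classical
  refine ⟨measurable_extend he, Measure.eq_infinitePi _ fun s t ht => ?_⟩
  have hpre : (fun q : (κ → X) × (ι → X) => Function.extend e q.1 q.2) ⁻¹' (s : Set ι).pi t =
      (s.preimage e he.injOn : Set κ).pi (fun k => t (e k)) ×ˢ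
        (({i ∈ s | i ∉ Set.range e} : Finset ι) : Set ι).pi t := by
    have hdiff : (s : Set ι) \ Set.range e = ({i ∈ s | i ∉ Set.range e} : Finset ι) :=
      (Finset.coe_filter _ s).symm
    ext q
    rw [Set.mem_preimage, extend_mem_pi_iff he, Set.mem_prod, Finset.coe_preimage, hdiff]
  rw [Measure.map_apply (measurable_extend he) (.pi s.countable_toSet fun i _ => ht i), hpre,
    Measure.prod_prod, Measure.infinitePi_pi _ fun k _ => ht (e k),
    Measure.infinitePi_pi _ fun i _ => ht i,
    ← Finset.prod_filter_mul_prod_filter_not s (· ∈ Set.range e)]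
  exact congrArg (· * _) (Finset.prod_preimage' e s he.injOn fun i => μ (t i))

end InfiniteProduct

section Psi

instance : IsProbabilityMeasure unifDom :=
  inferInstanceAs (IsProbabilityMeasure (Measure.infinitePi fun _ : ℕ => unif))

lemma Psi_eq_prod {ν : ℕ →₀ ℕ} {s : Finset ℕ} (hs : ν.support ⊆ s) (y : Dom) :
    Psi ν y = ∏ i ∈ s, psi (ν i) (y i) :=
  ν.prod_of_support_subset hs (fun i n => psi n (y i)) fun _ _ => psi_zero _

@[fun_prop]
lemma continuous_Psi (ν : ℕ →₀ ℕ) : Continuous (Psi ν) := by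
  unfold Psi
  fun_prop

lemma Psi_extend {ν : ℕ →₀ ℕ} {m : ℕ} (hm : ν.support ⊆ Finset.range m)
    (x : Fin m → Set.Icc (-1 : ℝ) 1) (y : Dom) :
    Psi ν (Function.extend Fin.val x y) = ∏ i : Fin m, psi (ν i) (x i) := by
  rw [Psi_eq_prod hm, Finset.prod_range]
  simp only [Fin.val_injective.extend_apply]

lemma integrable_Psi_smul {E : Type*} [NormedAddCommGroup E] [NormedSpace ℝ E] (ν : ℕ →₀ ℕ)
    {f : Dom → E} (hf : Integrable f unifDom) : Integrable (fun y => Psi ν y • f y) unifDom := by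
  obtain ⟨C, hC⟩ := isCompact_univ.exists_bound_of_continuousOn (continuous_Psi ν).continuousOn
  exact hf.bdd_smul C (continuous_Psi ν).aestronglyMeasurable (ae_of_all _ fun y => hC y trivial)

lemma measurePreserving_extend_unifDom (m : ℕ) :
    MeasurePreserving
      (fun q : (Fin m → Set.Icc (-1 : ℝ) 1) × Dom => (Function.extend Fin.val q.1 q.2 : Dom))
      ((Measure.pi fun _ => unif).prod unifDom) unifDom := by
  rw [← Measure.infinitePi_eq_pi]
  exact measurePreserving_extend unif Fin.val_injective

lemma norm_integral_unifDom_le {E : Type*} [NormedAddCommGroup E] [NormedSpace ℝ E] {m : ℕ}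
    {F : Dom → E} (hF : Integrable F unifDom) {C : ℝ}
    (hC : ∀ y : Dom, ‖∫ x : Fin m → Set.Icc (-1 : ℝ) 1, F (Function.extend Fin.val x y)
      ∂Measure.pi fun _ => unif‖ ≤ C) :
    ‖∫ y, F y ∂unifDom‖ ≤ C := by
  have hmp := measurePreserving_extend_unifDom m
  rw [← hmp.map_eq] at hF ⊢
  rw [integral_map hmp.measurable.aemeasurable hF.aestronglyMeasurable,
    integral_prod_symm (fun q : _ × Dom => F (Function.extend Fin.val q.1 q.2))
      (hF.comp_measurable hmp.measurable)]
  simpa using norm_integral_le_of_norm_le_const (μ := unifDom) (ae_of_all _ hC)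

end Psi

section PolyellipseSlices

variable {ρ : ℕ → ℝ} {m : ℕ}

lemma ofReal_mem_polyellipse (hρ : ∀ j, 1 ≤ ρ j) (y : Dom) :
    (fun j => ((y j : ℝ) : ℂ)) ∈ polyellipse ρ :=
  fun j => ofReal_mem_ellipse (hρ j) (y j).2

lemma extend_mem_polyellipse {z : Fin m → ℂ} (hz : ∀ i : Fin m, z i ∈ ellipse (ρ i)) {w : ℕ → ℂ}
    (hw : w ∈ polyellipse ρ) : Function.extend Fin.val z w ∈ polyellipse ρ := by
  intro j
  by_cases hj : ∃ i : Fin m, i.val = j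
  · obtain ⟨i, rfl⟩ := hj
    exact (Fin.val_injective.extend_apply z w i).symm ▸ hz i
  · exact (Function.extend_apply' z w j hj).symm ▸ hw j

lemma extend_update {κ ι X : Type*} [DecidableEq κ] [DecidableEq ι] {e : κ → ι}
    (he : Function.Injective e) (z : κ → X) (w : ι → X) (k : κ) (x : X) :
    Function.extend e (Function.update z k x) w =
      Function.update (Function.extend e z w) (e k) x := by
  ext i
  by_cases hi : ∃ k', e k' = i
  · obtain ⟨k', rfl⟩ := hi
    simp only [he.extend_apply, Function.update_apply, he.eq_iff]
  · rw [Function.extend_apply' _ _ _ hi, Function.update_of_ne fun h => hi ⟨k, h.symm⟩,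
      Function.extend_apply' _ _ _ hi]

lemma HolomorphicIn.separatelyHolomorphic_extend {W : Type*} [NormedAddCommGroup W]
    [NormedSpace ℂ W] {O : Set (ℕ → ℂ)} {g : (ℕ → ℂ) → W} (hg : HolomorphicIn O g)
    (hO : polyellipse ρ ⊆ O) {w : ℕ → ℂ} (hw : w ∈ polyellipse ρ) :
    SeparatelyHolomorphic (fun i : Fin m => ellipse (ρ i))
      fun z => g (Function.extend Fin.val z w) := by
  intro z hz i
  simpa only [extend_update Fin.val_injective, Fin.val_injective.extend_apply] using
    hg _ (hO (extend_mem_polyellipse hz hw)) i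

end PolyellipseSlices

section Bound

variable {V W : Type*} [NormedAddCommGroup V] [NormedSpace ℝ V] [NormedAddCommGroup W]
  [NormedSpace ℂ W] {ι : V →ₗᵢ[ℝ] W} {b : ℕ → ℝ} {f : Dom → V}

lemma norm_le_one_of_mem_holoClass (hf : f ∈ holoClass ι b) (y : Dom) : ‖f y‖ ≤ 1 := by
  obtain ⟨O, g, -, -, -, hfg, hg⟩ := hf
  rw [← ι.norm_map, ← hfg]
  exact hg _ ⟨fun _ => 1, fun _ => le_rfl, by simp, by simp,
    ofReal_mem_polyellipse (fun _ => le_rfl) y⟩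

lemma memLp_of_mem_holoClass (hf : f ∈ holoClass ι b) (hm : AEStronglyMeasurable f unifDom)
    (p : ℝ≥0∞) : MemLp f p unifDom :=
  MemLp.of_bound hm 1 (ae_of_all _ (norm_le_one_of_mem_holoClass hf))

lemma map_coeff [CompleteSpace V] [CompleteSpace W] (ι : V →ₗᵢ[ℝ] W)
    (hf : Integrable f unifDom) (ν : ℕ →₀ ℕ) :
    ι (coeff f ν) = ∫ y, Psi ν y • ι (f y) ∂unifDom := by
  simp only [← map_smul]
  exact (ι.toContinuousLinearMap.integral_comp_comm (integrable_Psi_smul ν hf)).symm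

theorem norm_coeff_le [CompleteSpace V] [CompleteSpace W] (hf : f ∈ holoClass ι b)
    (hm : AEStronglyMeasurable f unifDom) (ν : ℕ →₀ ℕ) {ρ : ℕ → ℝ} (hρ : ∀ j, 1 ≤ ρ j)
    (hν : ∀ j, ν j ≠ 0 → 1 < ρ j) (hsum : Summable fun j => ((ρ j + (ρ j)⁻¹) / 2 - 1) * b j)
    (hle : ∑' j, ((ρ j + (ρ j)⁻¹) / 2 - 1) * b j ≤ 1) :
    ‖coeff f ν‖ ≤ ν.prod fun j n => ellipseFactor n (ρ j) := by
  obtain ⟨m, hνm⟩ := ν.support.exists_nat_subset_range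
  have hfi : Integrable f unifDom := (memLp_of_mem_holoClass hf hm 1).integrable le_rfl
  obtain ⟨O, g, -, hO, hhol, hfg, hg⟩ := hf
  have hregion : polyellipse ρ ⊆ region b 1 := fun z hz => ⟨ρ, hρ, hsum, hle, hz⟩
  have hslice (y : Dom) := SeparatelyHolomorphic.norm_integral_prod_psi_smul_le
    (fun i : Fin m => hρ i) (fun i => hν i)
    (hhol.separatelyHolomorphic_extend (hregion.trans hO) (ofReal_mem_polyellipse hρ y))
    fun z hz => hg _ (hregion (extend_mem_polyellipse hz (ofReal_mem_polyellipse hρ y)))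
  have hreal (x : Fin m → Set.Icc (-1 : ℝ) 1) (y : Dom) :
      g (Function.extend Fin.val (fun i => ((x i : ℝ) : ℂ)) fun j => ((y j : ℝ) : ℂ)) =
        ι (f (Function.extend Fin.val x y)) := by
    rw [← hfg]
    exact congrArg g (funext fun j =>
      (Function.apply_extend (fun t : Set.Icc (-1 : ℝ) 1 => ((t : ℝ) : ℂ)) _ _ _).symm)
  rw [← ι.norm_map, map_coeff ι hfi, ν.prod_of_support_subset hνm _ fun _ _ => ellipseFactor_zero _,
    Finset.prod_range]
  refine norm_integral_unifDom_le (m := m)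
    (integrable_Psi_smul ν (ι.toContinuousLinearMap.integrable_comp hfi)) fun y => ?_
  simpa only [Psi_extend hνm, LinearIsometry.coe_toContinuousLinearMap, ← hreal,
    ← Complex.coe_smul, Complex.ofReal_prod, mul_one] using hslice y

end Bound

/-! ### Summable families of multi-indices -/

section MultiIndex

variable {σ : Type*}

/-- The term `|n|! / n! * γ^n` of the multinomial series in the variables `γ`. -/
def multinomialTerm (γ : σ → ℝ) (n : σ →₀ ℕ) : ℝ :=
  n.multinomial * n.prod fun j k => γ j ^ k

lemma multinomialTerm_nonneg {γ : σ → ℝ} (hγ : ∀ j, 0 ≤ γ j) (n : σ →₀ ℕ) :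
    0 ≤ multinomialTerm γ n :=
  mul_nonneg n.multinomial.cast_nonneg (Finset.prod_nonneg fun j _ => pow_nonneg (hγ j) _)

lemma sum_finsuppAntidiag_multinomialTerm [DecidableEq σ] (γ : σ → ℝ) (s : Finset σ) (k : ℕ) :
    ∑ n ∈ s.finsuppAntidiag k, multinomialTerm γ n = (∑ j ∈ s, γ j) ^ k := by
  rw [Finset.sum_pow_eq_sum_piAntidiag]
  refine Finset.sum_nbij (fun n => ⇑n) (fun n hn => ?_) DFunLike.coe_injective.injOn
    (fun f hf => ?_) fun n hn => ?_
  · obtain ⟨hk, hs⟩ := Finset.mem_finsuppAntidiag.1 hn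
    exact Finset.mem_piAntidiag.2 ⟨hk, fun j hj => hs (Finsupp.mem_support_iff.2 hj)⟩
  · obtain ⟨hk, hs⟩ := Finset.mem_piAntidiag.1 hf
    exact ⟨Finsupp.onFinset s f hs,
      Finset.mem_finsuppAntidiag.2 ⟨hk, Finsupp.support_onFinset_subset⟩, rfl⟩
  · have hs := (Finset.mem_finsuppAntidiag.1 hn).2
    rw [multinomialTerm, Finsupp.multinomial_eq_of_support_subset hs,
      n.prod_of_support_subset hs _ fun j _ => pow_zero _]

lemma summable_multinomialTerm {γ : σ → ℝ} (hγ : ∀ j, 0 ≤ γ j) (hs : Summable γ)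
    (h1 : ∑' j, γ j < 1) : Summable (multinomialTerm γ) := by
  classical
  have hΓ : 0 ≤ ∑' j, γ j := tsum_nonneg hγ
  refine summable_of_sum_le (c := ∑' k, (∑' j, γ j) ^ k) (multinomialTerm_nonneg hγ) fun T => ?_
  set s : Finset σ := T.biUnion Finsupp.support
  have hslice (k : ℕ) : ∑ n ∈ T with n.degree = k, multinomialTerm γ n ≤ (∑' j, γ j) ^ k := by
    calc ∑ n ∈ T with n.degree = k, multinomialTerm γ n
        ≤ ∑ n ∈ s.finsuppAntidiag k, multinomialTerm γ n := by
          refine Finset.sum_le_sum_of_subset_of_nonneg (fun n hn => ?_)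
            fun n _ _ => multinomialTerm_nonneg hγ n
          obtain ⟨hnT, hnk⟩ := Finset.mem_filter.1 hn
          have hns : n.support ⊆ s := Finset.subset_biUnion_of_mem Finsupp.support hnT
          refine Finset.mem_finsuppAntidiag.2 ⟨?_, hns⟩
          rw [← hnk, Finsupp.degree_apply]
          exact (n.sum_of_support_subset hns (fun _ k => k) fun _ _ => rfl).symm
      _ = (∑ j ∈ s, γ j) ^ k := sum_finsuppAntidiag_multinomialTerm γ s k
      _ ≤ (∑' j, γ j) ^ k := pow_le_pow_left₀ (Finset.sum_nonneg fun j _ => hγ j)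
          (hs.sum_le_tsum s fun j _ => hγ j) k
  rw [← Finset.sum_fiberwise_of_maps_to fun n hn => Finset.mem_image_of_mem Finsupp.degree hn]
  exact (Finset.sum_le_sum fun k _ => hslice k).trans
    ((summable_geometric_of_lt_one hΓ h1).sum_le_tsum _ fun k _ => pow_nonneg hΓ k)

lemma multinomialTerm_rpow_le {p : ℝ} (hp1 : p ≤ 1) {γ : σ → ℝ} (hγ : ∀ j, 0 ≤ γ j)
    (n : σ →₀ ℕ) : multinomialTerm γ n ^ p ≤ multinomialTerm (fun j => γ j ^ p) n := by
  have hmulti : (1 : ℝ) ≤ n.multinomial := by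
    rw [Finsupp.multinomial_eq]
    exact_mod_cast Nat.multinomial_pos n.support n
  have hpow (j : σ) : 0 ≤ γ j ^ n j := pow_nonneg (hγ j) _
  simp only [multinomialTerm, Finsupp.prod, Real.rpow_pow_comm (hγ _)]
  rw [Real.mul_rpow (by linarith) (Finset.prod_nonneg fun j _ => hpow j),
    ← Real.finsetProd_rpow _ _ fun j _ => hpow j]
  exact mul_le_mul_of_nonneg_right (Real.rpow_le_self_of_one_le hmulti hp1)
    (Finset.prod_nonneg fun j _ => Real.rpow_nonneg (hpow j) _)

lemma summable_prod_of_nonneg {ι κ : Type*} [Fintype ι] {f : ι → κ → ℝ} (h0 : ∀ i k, 0 ≤ f i k)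
    (hf : ∀ i, Summable (f i)) : Summable fun a : ι → κ => ∏ i, f i (a i) := by
  classical
  refine summable_of_sum_le (c := ∏ i, ∑' k, f i k)
    (fun a => Finset.prod_nonneg fun i _ => h0 i _) fun T => ?_
  calc ∑ a ∈ T, ∏ i, f i (a i)
      ≤ ∑ a ∈ Fintype.piFinset fun i => T.image (· i), ∏ i, f i (a i) :=
        Finset.sum_le_sum_of_subset_of_nonneg
          (fun a ha => Fintype.mem_piFinset.2 fun i => Finset.mem_image_of_mem (· i) ha)
          fun a _ _ => Finset.prod_nonneg fun i _ => h0 i _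
    _ = ∏ i, ∑ k ∈ T.image (· i), f i k := (Finset.prod_univ_sum _ _).symm
    _ ≤ ∏ i, ∑' k, f i k := Finset.prod_le_prod
        (fun i _ => Finset.sum_nonneg fun k _ => h0 i k)
        fun i _ => (hf i).sum_le_tsum _ fun k _ => h0 i k

variable [DecidableEq σ]

lemma summable_head_mul_tail (H : Finset σ) {u : (H → ℕ) → ℝ} {v : (σ →₀ ℕ) → ℝ}
    (hu : Summable u) (hv : Summable v) (hu0 : ∀ a, 0 ≤ u a) (hv0 : ∀ n, 0 ≤ v n) :
    Summable fun ν : σ →₀ ℕ => u (fun i => ν i) * v (ν.filter (· ∉ H)) := by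
  refine (hu.mul_of_nonneg hv hu0 hv0).comp_injective
    (i := fun ν : σ →₀ ℕ => (fun i : H => ν i, ν.filter (· ∉ H))) fun ν μ h => ?_
  obtain ⟨hhead, htail⟩ := Prod.mk.inj h
  ext j
  by_cases hj : j ∈ H
  · exact congrFun hhead ⟨j, hj⟩
  · simpa only [Finsupp.filter_apply_pos (· ∉ H) _ hj] using DFunLike.congr_fun htail j

/-- A bound for the Legendre coefficients: geometric decay in the finitely many coordinates in `H`
and multinomial decay in the others. -/
def coeffBound (K κ : ℝ) (H : Finset σ) (α : σ → ℝ) (ν : σ →₀ ℕ) : ℝ :=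
  K ^ H.card * (∏ i ∈ H, κ⁻¹ ^ ν i) * multinomialTerm α (ν.filter (· ∉ H))

lemma coeffBound_nonneg {K κ : ℝ} (hK : 0 ≤ K) (hκ : 0 ≤ κ) (H : Finset σ) {α : σ → ℝ}
    (hα : ∀ j, 0 ≤ α j) (ν : σ →₀ ℕ) : 0 ≤ coeffBound K κ H α ν :=
  mul_nonneg (by positivity) (multinomialTerm_nonneg hα _)

lemma coeffBound_rpow_le {p : ℝ} (hp1 : p ≤ 1) {K κ : ℝ} (hK : 0 ≤ K) (hκ : 0 ≤ κ)
    (H : Finset σ) {α : σ → ℝ} (hα : ∀ j, 0 ≤ α j) (ν : σ →₀ ℕ) :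
    coeffBound K κ H α ν ^ p ≤
      coeffBound (K ^ p) (κ ^ p) H ((H : Set σ)ᶜ.indicator fun j => α j ^ p) ν := by
  have hindicator : multinomialTerm (fun j => α j ^ p) (ν.filter (· ∉ H)) =
      multinomialTerm ((H : Set σ)ᶜ.indicator fun j => α j ^ p) (ν.filter (· ∉ H)) := by
    refine congrArg _ (Finsupp.prod_congr fun j hj => ?_)
    rw [Set.indicator_of_mem]
    exact (Finset.mem_filter.1 (Finsupp.support_filter (· ∉ H) ν ▸ hj)).2
  rw [coeffBound, Real.mul_rpow (by positivity) (multinomialTerm_nonneg hα _),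
    Real.mul_rpow (by positivity) (by positivity), ← Real.rpow_pow_comm hK,
    ← Real.finsetProd_rpow _ _ fun i _ => by positivity, coeffBound, ← hindicator]
  simp only [← Real.rpow_pow_comm (inv_nonneg.2 hκ), Real.inv_rpow hκ]
  exact mul_le_mul_of_nonneg_left (multinomialTerm_rpow_le hp1 hα _) (by positivity)

lemma summable_coeffBound (K : ℝ) {κ : ℝ} (hκ : 1 < κ) (H : Finset σ) {α : σ → ℝ}
    (hα : ∀ j, 0 ≤ α j) (hs : Summable α) (h1 : ∑' j, α j < 1) :
    Summable (coeffBound K κ H α) := by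
  have hκ0 : 0 ≤ κ⁻¹ := inv_nonneg.2 (zero_le_one.trans hκ.le)
  have hhead : Summable fun a : H → ℕ => ∏ i, κ⁻¹ ^ a i :=
    summable_prod_of_nonneg (fun _ k => pow_nonneg hκ0 k)
      fun _ => summable_geometric_of_lt_one hκ0 (inv_lt_one_of_one_lt₀ hκ)
  have hprod := (summable_head_mul_tail H hhead (summable_multinomialTerm hα hs h1)
    (fun a => by positivity) (multinomialTerm_nonneg hα)).mul_left (K ^ H.card)
  refine hprod.congr fun ν => ?_
  rw [coeffBound, mul_assoc, Finset.prod_coe_sort H fun i => κ⁻¹ ^ ν i]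

lemma summable_coeffBound_rpow {p : ℝ} (hp0 : 0 < p) (hp1 : p ≤ 1) {K κ : ℝ} (hK : 0 ≤ K)
    (hκ : 1 < κ) {H : Finset σ} {α : σ → ℝ} (hα : ∀ j, 0 ≤ α j)
    (hs : Summable fun j => α j ^ p) (hH : ∑' j : {j // j ∉ H}, α j ^ p < 1) :
    Summable fun ν => coeffBound K κ H α ν ^ p := by
  have hκ0 : 0 ≤ κ := zero_le_one.trans hκ.le
  refine (summable_coeffBound (K ^ p) (Real.one_lt_rpow hκ hp0) H ?_
    (hs.indicator (H : Set σ)ᶜ) ?_).of_nonneg_of_le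
    (fun ν => Real.rpow_nonneg (coeffBound_nonneg hK hκ0 H hα ν) p)
    (coeffBound_rpow_le hp1 hK hκ0 H hα)
  · exact fun j => Set.indicator_nonneg (fun j _ => Real.rpow_nonneg (hα j) p) j
  · rwa [← tsum_subtype]

end MultiIndex

/-! ### The choice of the polyellipse -/

lemma half_add_inv_sub_one_le {ρ : ℝ} (hρ : 1 ≤ ρ) : (ρ + ρ⁻¹) / 2 - 1 ≤ (ρ - 1) / 2 := by
  linarith [inv_le_one_of_one_le₀ hρ]

lemma half_add_inv_sub_one_nonneg {ρ : ℝ} (hρ : 1 ≤ ρ) : 0 ≤ (ρ + ρ⁻¹) / 2 - 1 := by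
  have := one_pos.trans_le hρ
  have hsq : (ρ + ρ⁻¹) / 2 - 1 = (ρ - 1) ^ 2 / (2 * ρ) := by
    field_simp
    ring
  rw [hsq]
  positivity

lemma two_mul_div_sub_one_le {κ ρ : ℝ} (hκ : 1 < κ) (h : κ ≤ ρ) :
    2 * ρ / (ρ - 1) ≤ 2 * κ / (κ - 1) := by
  rw [div_le_div_iff₀ (by linarith) (by linarith)]
  nlinarith

lemma one_le_two_mul_div_sub_one {κ : ℝ} (hκ : 1 < κ) : 1 ≤ 2 * κ / (κ - 1) := by
  rw [one_le_div (sub_pos.2 hκ)]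
  linarith

lemma ellipseFactor_le {κ r ρ : ℝ} (hκ : 1 < κ) (hκρ : κ ≤ ρ) (hr : 0 < r) (hrρ : r ≤ ρ) (n : ℕ) :
    ellipseFactor n ρ ≤ 2 * κ / (κ - 1) * (r ^ n)⁻¹ := by
  have hK := one_le_two_mul_div_sub_one hκ
  rw [ellipseFactor]
  split_ifs with hn
  · simpa only [hn, pow_zero, inv_one, mul_one] using hK
  · exact mul_le_mul (two_mul_div_sub_one_le hκ hκρ)
      (inv_anti₀ (pow_pos hr n) (pow_le_pow_left₀ hr.le hrρ n))
      (inv_nonneg.2 (pow_nonneg (hr.le.trans hrρ) n)) (zero_le_one.trans hK)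

lemma pow_self_le_exp_mul_factorial (n : ℕ) :
    (n : ℝ) ^ n ≤ Real.exp 1 ^ n * (n.factorial : ℝ) := by
  have h := Real.pow_div_factorial_le_exp (x := n) n.cast_nonneg n
  rwa [div_le_iff₀ (by exact_mod_cast n.factorial_pos), ← mul_one (n : ℝ), Real.exp_nat_mul,
    mul_one] at h

section Radii

variable {σ : Type*}

lemma degree_pow_degree_le (n : σ →₀ ℕ) :
    (n.degree : ℝ) ^ n.degree ≤
      Real.exp 1 ^ n.degree * n.multinomial * n.prod fun _ k => (k : ℝ) ^ k := by
  have hfactorial : (∏ j ∈ n.support, (n j).factorial) * n.multinomial = n.degree.factorial :=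
    Nat.multinomial_spec _ _
  have hprod : ∏ j ∈ n.support, (n j).factorial ≤ ∏ j ∈ n.support, n j ^ n j :=
    Finset.prod_le_prod' fun j _ => Nat.factorial_le_pow (n j)
  calc (n.degree : ℝ) ^ n.degree
      ≤ Real.exp 1 ^ n.degree * n.degree.factorial := pow_self_le_exp_mul_factorial _
    _ = Real.exp 1 ^ n.degree * n.multinomial * (∏ j ∈ n.support, (n j).factorial : ℕ) := by
      rw [← hfactorial]
      push_cast
      ring
    _ ≤ Real.exp 1 ^ n.degree * n.multinomial * n.prod fun _ k => (k : ℝ) ^ k := by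
      refine mul_le_mul_of_nonneg_left ?_ (by positivity)
      rw [Finsupp.prod]
      exact_mod_cast hprod

lemma prod_mul_inv_pow_le_multinomialTerm {K : ℝ} (hK : 1 ≤ K) {b : σ → ℝ} (hb : ∀ j, 0 ≤ b j)
    (n : σ →₀ ℕ) :
    n.prod (fun j k => K * ((k / (n.degree * b j)) ^ k)⁻¹) ≤
      multinomialTerm (fun j => Real.exp 1 * K * b j) n := by
  have hK0 : 0 ≤ K := zero_le_one.trans hK
  have hKb (j : σ) : 0 ≤ K * b j := mul_nonneg hK0 (hb j)
  have hself (j : σ) : (0 : ℝ) < (n j : ℝ) ^ n j := by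
    exact_mod_cast Nat.pow_self_pos
  calc n.prod (fun j k => K * ((k / (n.degree * b j)) ^ k)⁻¹)
      ≤ n.prod fun j k => (n.degree : ℝ) ^ k * ((k : ℝ) ^ k)⁻¹ * (K * b j) ^ k := by
        refine Finset.prod_le_prod (fun j _ => ?_) fun j hj => ?_
        · have := hb j
          positivity
        · have := hb j
          calc K * (((n j : ℝ) / (n.degree * b j)) ^ n j)⁻¹
              ≤ K ^ n j * (((n j : ℝ) / (n.degree * b j)) ^ n j)⁻¹ :=
                mul_le_mul_of_nonneg_right (le_self_pow₀ hK (Finsupp.mem_support_iff.1 hj))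
                  (by positivity)
            _ = (n.degree : ℝ) ^ n j * ((n j : ℝ) ^ n j)⁻¹ * (K * b j) ^ n j := by
                rw [← inv_pow, inv_div, div_pow, mul_pow, mul_pow]
                ring
    _ = (n.degree : ℝ) ^ n.degree * (n.prod fun _ k => (k : ℝ) ^ k)⁻¹ *
          n.prod fun j k => (K * b j) ^ k := by
        simp only [Finsupp.prod, Finset.prod_mul_distrib, Finset.prod_pow_eq_pow_sum,
          Finset.prod_inv_distrib, Finsupp.degree_apply]
    _ ≤ Real.exp 1 ^ n.degree * n.multinomial * n.prod fun j k => (K * b j) ^ k := by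
        refine mul_le_mul_of_nonneg_right ?_ (Finset.prod_nonneg fun j _ => pow_nonneg (hKb j) _)
        exact (mul_inv_le_iff₀ (Finset.prod_pos fun j _ => hself j)).2 (degree_pow_degree_le n)
    _ = multinomialTerm (fun j => Real.exp 1 * K * b j) n := by
        simp only [multinomialTerm, Finsupp.prod, mul_assoc (Real.exp 1), mul_pow (Real.exp 1),
          Finset.prod_mul_distrib, Finset.prod_pow_eq_pow_sum, Finsupp.degree_apply]
        ring

lemma hasSum_div_degree (n : σ →₀ ℕ) :
    HasSum (fun j => (n j : ℝ) / n.degree) (n.degree / n.degree) := by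
  refine HasSum.div_const ?_ _
  rw [Finsupp.degree_apply, Nat.cast_sum]
  refine hasSum_sum_of_ne_finset_zero fun j hj => ?_
  rw [Finsupp.notMem_support_iff.1 hj, Nat.cast_zero]

lemma summable_of_summable_rpow {p : ℝ} (hp0 : 0 < p) (hp1 : p ≤ 1) {b : σ → ℝ}
    (hb : ∀ j, 0 ≤ b j) (hbp : Summable fun j => b j ^ p) : Summable b := by
  refine Summable.of_norm_bounded_eventually hbp ?_
  filter_upwards [hbp.tendsto_cofinite_zero.eventually (gt_mem_nhds zero_lt_one)] with j hj
  have hj1 : b j ≤ 1 := by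
    by_contra! h
    exact (Real.one_lt_rpow h hp0).not_gt hj
  rw [Real.norm_of_nonneg (hb j)]
  exact Real.self_le_rpow_of_le_one (hb j) hj1 hp1

/-- Every `B ν` dominates the bound for the `ν`-th Legendre coefficient of the functions in `H(b)`
that comes from some polyellipse in `R(b, 1)`. The polyellipse may depend on `ν`. -/
def IsPolyellipseMajorant (b : σ → ℝ) (B : (σ →₀ ℕ) → ℝ) : Prop :=
  ∀ ν, ∃ ρ : σ → ℝ, (∀ j, 1 < ρ j) ∧ (Summable fun j => ((ρ j + (ρ j)⁻¹) / 2 - 1) * b j) ∧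
    ∑' j, ((ρ j + (ρ j)⁻¹) / 2 - 1) * b j ≤ 1 ∧ ν.prod (fun j k => ellipseFactor k (ρ j)) ≤ B ν

lemma IsPolyellipseMajorant.anti {b b' : σ → ℝ} {B : (σ →₀ ℕ) → ℝ}
    (hB : IsPolyellipseMajorant b' B) (hb : ∀ j, 0 ≤ b j) (h : ∀ j, b j ≤ b' j) :
    IsPolyellipseMajorant b B := by
  intro ν
  obtain ⟨ρ, hρ, hsum, hle, hprod⟩ := hB ν
  have hnonneg (j : σ) := half_add_inv_sub_one_nonneg (hρ j).le
  have hmono (j : σ) :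
      ((ρ j + (ρ j)⁻¹) / 2 - 1) * b j ≤ ((ρ j + (ρ j)⁻¹) / 2 - 1) * b' j :=
    mul_le_mul_of_nonneg_left (h j) (hnonneg j)
  have hsum' := hsum.of_nonneg_of_le (fun j => mul_nonneg (hnonneg j) (hb j)) hmono
  exact ⟨ρ, hρ, hsum', (hsum'.tsum_le_tsum hmono hsum).trans hle, hprod⟩

variable [DecidableEq σ]

/-- The radii of a polyellipse adapted to the multi-index `ν`: they are `κ` on the finite set `H`
of head coordinates and are increased in the other coordinates, in proportion to `ν j / b j`. -/
def radii (κ : ℝ) (H : Finset σ) (b : σ → ℝ) (ν : σ →₀ ℕ) (j : σ) : ℝ :=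
  κ + ν.filter (· ∉ H) j / ((ν.filter (· ∉ H)).degree * b j)

variable {κ : ℝ} {b : σ → ℝ}

lemma le_radii (κ : ℝ) (H : Finset σ) (hb : ∀ j, 0 ≤ b j) (ν : σ →₀ ℕ) (j : σ) :
    κ ≤ radii κ H b ν j :=
  le_add_of_nonneg_right (div_nonneg (Nat.cast_nonneg _) (mul_nonneg (Nat.cast_nonneg _) (hb j)))

lemma radii_budget_le (hκ : 1 < κ) (H : Finset σ) (hb : ∀ j, 0 < b j) (ν : σ →₀ ℕ)
    (hs : Summable b) (hκb : (κ - 1) * ∑' j, b j ≤ 1) :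
    Summable (fun j => ((radii κ H b ν j + (radii κ H b ν j)⁻¹) / 2 - 1) * b j) ∧
      ∑' j, ((radii κ H b ν j + (radii κ H b ν j)⁻¹) / 2 - 1) * b j ≤ 1 := by
  set n := ν.filter (· ∉ H)
  have h1 (j : σ) : 1 ≤ radii κ H b ν j := hκ.le.trans (le_radii κ H (fun j => (hb j).le) ν j)
  have hle (j : σ) : ((radii κ H b ν j + (radii κ H b ν j)⁻¹) / 2 - 1) * b j ≤
      ((κ - 1) * b j + n j / n.degree) / 2 := by
    refine (mul_le_mul_of_nonneg_right (half_add_inv_sub_one_le (h1 j)) (hb j).le).trans_eq ?_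
    have := (hb j).ne'
    rw [radii, ← div_div]
    field_simp
    ring
  have hbound := ((hs.hasSum.mul_left (κ - 1)).add (hasSum_div_degree n)).div_const 2
  have hsummable := hbound.summable.of_nonneg_of_le
    (fun j => mul_nonneg (half_add_inv_sub_one_nonneg (h1 j)) (hb j).le) hle
  refine ⟨hsummable, (hasSum_le hle hsummable.hasSum hbound).trans ?_⟩
  linarith [div_self_le_one (n.degree : ℝ)]

lemma prod_ellipseFactor_radii_le (hκ : 1 < κ) (H : Finset σ) (hb : ∀ j, 0 < b j) (ν : σ →₀ ℕ) :
    ν.prod (fun j k => ellipseFactor k (radii κ H b ν j)) ≤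
      coeffBound (2 * κ / (κ - 1)) κ H (fun j => Real.exp 1 * (2 * κ / (κ - 1)) * b j) ν := by
  set K := 2 * κ / (κ - 1)
  have hK : 1 ≤ K := one_le_two_mul_div_sub_one hκ
  have hκ0 : 0 < κ := one_pos.trans hκ
  have hκρ (j : σ) : κ ≤ radii κ H b ν j := le_radii κ H (fun j => (hb j).le) ν j
  have hfactor0 (j : σ) (k : ℕ) : 0 ≤ ellipseFactor k (radii κ H b ν j) :=
    ellipseFactor_nonneg (hκ.le.trans (hκρ j))
  rw [← Finsupp.prod_filter_mul_prod_filter_not (· ∈ H), coeffBound]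
  refine mul_le_mul ?_ ?_ (Finset.prod_nonneg fun j _ => hfactor0 j _) (by positivity)
  · have hsupport : (ν.filter (· ∈ H)).support ⊆ H := by
      rw [Finsupp.support_filter]
      exact fun j hj => (Finset.mem_filter.1 hj).2
    rw [← Finset.prod_const, ← Finset.prod_mul_distrib,
      Finsupp.prod_of_support_subset _ hsupport _ fun j _ => ellipseFactor_zero _]
    refine Finset.prod_le_prod (fun j _ => hfactor0 j _) fun j hj => ?_
    rw [Finsupp.filter_apply_pos (· ∈ H) _ hj, inv_pow]
    exact ellipseFactor_le hκ (hκρ j) hκ0 (hκρ j) (ν j)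
  · refine (Finset.prod_le_prod (fun j _ => hfactor0 j _) fun j hj => ?_).trans
      (prod_mul_inv_pow_le_multinomialTerm hK (fun j => (hb j).le) (ν.filter (· ∉ H)))
    have hnj : 0 < ν.filter (· ∉ H) j := Nat.pos_of_ne_zero (Finsupp.mem_support_iff.1 hj)
    have hdegree : 0 < (ν.filter (· ∉ H)).degree := hnj.trans_le (Finsupp.le_degree _ _)
    have := hb j
    exact ellipseFactor_le hκ (hκρ j) (by positivity) (le_add_of_nonneg_left hκ0.le) _

end Radii

lemma exists_isPolyellipseMajorant_of_pos {σ : Type*} {b : σ → ℝ} {p : ℝ} (hp0 : 0 < p)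
    (hp1 : p ≤ 1) (hb : ∀ j, 0 < b j) (hbp : Summable fun j => b j ^ p) :
    ∃ B : (σ →₀ ℕ) → ℝ, (∀ ν, 0 ≤ B ν) ∧ (Summable fun ν => B ν ^ p) ∧
      IsPolyellipseMajorant b B := by
  classical
  have hb0 (j : σ) : 0 ≤ b j := (hb j).le
  have hbs := summable_of_summable_rpow hp0 hp1 hb0 hbp
  set κ : ℝ := 1 + (1 + ∑' j, b j)⁻¹ with hκdef
  have hsum0 : 0 ≤ ∑' j, b j := tsum_nonneg hb0
  have hκ : 1 < κ := lt_add_of_pos_right _ (by positivity)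
  have hκb : (κ - 1) * ∑' j, b j ≤ 1 := by
    rw [hκdef, add_sub_cancel_left, inv_mul_le_iff₀ (by positivity)]
    linarith
  set K := 2 * κ / (κ - 1)
  have hK : 0 ≤ K := zero_le_one.trans (one_le_two_mul_div_sub_one hκ)
  set α : σ → ℝ := fun j => Real.exp 1 * K * b j
  have hα (j : σ) : 0 ≤ α j := mul_nonneg (by positivity) (hb0 j)
  have hαp : Summable fun j => α j ^ p :=
    (hbp.mul_left ((Real.exp 1 * K) ^ p)).congr fun j =>
      (Real.mul_rpow (by positivity) (hb0 j)).symm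
  obtain ⟨H, hH⟩ : ∃ H : Finset σ, ∑' j : {j // j ∉ H}, α j ^ p < 1 :=
    ((tendsto_tsum_compl_atTop_zero fun j => α j ^ p).eventually
      (gt_mem_nhds zero_lt_one)).exists
  refine ⟨coeffBound K κ H α, coeffBound_nonneg hK (zero_le_one.trans hκ.le) H hα,
    summable_coeffBound_rpow hp0 hp1 hK hκ hα hαp hH, fun ν => ?_⟩
  obtain ⟨hsummable, hle⟩ := radii_budget_le hκ H hb ν hbs hκb
  exact ⟨radii κ H b ν, fun j => hκ.trans_le (le_radii κ H hb0 ν j), hsummable, hle,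
    prod_ellipseFactor_radii_le hκ H hb ν⟩

lemma exists_pos_summable_rpow_majorant {b : ℕ → ℝ} (hb : ∀ j, 0 ≤ b j) {p : ℝ} (hp : 0 < p)
    (hbp : Memℓp b (ENNReal.ofReal p)) :
    ∃ b' : ℕ → ℝ, (∀ j, 0 < b' j) ∧ (∀ j, b j ≤ b' j) ∧ Summable fun j => b' j ^ p := by
  have hp' : 0 < (ENNReal.ofReal p).toReal := by rwa [ENNReal.toReal_ofReal hp.le]
  have hpos (j : ℕ) : (0 : ℝ) < (1 / 2) ^ j := by positivity
  have hgeom : Memℓp (fun j : ℕ => (1 / 2 : ℝ) ^ j) (ENNReal.ofReal p) := by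
    refine (memℓp_gen_iff hp').2 ?_
    have hlt : (1 / 2 : ℝ) ^ p < 1 := Real.rpow_lt_one (by norm_num) (by norm_num) hp
    refine (summable_geometric_of_lt_one (by positivity) hlt).congr fun j => ?_
    rw [ENNReal.toReal_ofReal hp.le, Real.norm_of_nonneg (hpos j).le,
      Real.rpow_pow_comm (by norm_num)]
  refine ⟨fun j => b j + (1 / 2) ^ j, fun j => add_pos_of_nonneg_of_pos (hb j) (hpos j),
    fun j => le_add_of_nonneg_right (hpos j).le, ?_⟩
  refine ((memℓp_gen_iff hp').1 (hbp.add hgeom)).congr fun j => ?_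
  rw [ENNReal.toReal_ofReal hp.le, Pi.add_apply,
    Real.norm_of_nonneg (add_nonneg (hb j) (hpos j).le)]

theorem exists_isPolyellipseMajorant {b : ℕ → ℝ} (hb : ∀ j, 0 ≤ b j) {p : ℝ} (hp0 : 0 < p)
    (hp1 : p ≤ 1) (hbp : Memℓp b (ENNReal.ofReal p)) :
    ∃ B : (ℕ →₀ ℕ) → ℝ, (∀ ν, 0 ≤ B ν) ∧ (Summable fun ν => B ν ^ p) ∧
      IsPolyellipseMajorant b B := by
  obtain ⟨b', hb', hbb', hb'p⟩ := exists_pos_summable_rpow_majorant hb hp0 hbp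
  obtain ⟨B, hB0, hBp, hB⟩ := exists_isPolyellipseMajorant_of_pos hp0 hp1 hb' hb'p
  exact ⟨B, hB0, hBp, hB.anti hb hbb'⟩

/-! ### Best approximation of summable families -/

section Stechkin

variable {I V : Type*} [NormedAddCommGroup V] {B : I → ℝ} {c : I → V} {A p q τ : ℝ} {s : ℕ}

lemma exists_finset_card_eq_forall_notMem_le [Infinite I] (hp : 0 < p) (hB : ∀ i, 0 ≤ B i)
    (hsum : Summable fun i => B i ^ p) (hA0 : 0 < A) (hA : ∑' i, B i ^ p ≤ A) (hs : 1 ≤ s) :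
    ∃ S : Finset I, S.card = s ∧ ∀ i ∉ S, B i ≤ (A / s) ^ (1 / p) := by
  have hs0 : (0 : ℝ) < s := by exact_mod_cast hs
  have hfin : {i | ¬B i ^ p < A / s}.Finite :=
    hsum.tendsto_cofinite_zero.eventually (gt_mem_nhds (div_pos hA0 hs0))
  have hlarge : hfin.toFinset.card * (A / s) ≤ A := by
    calc hfin.toFinset.card * (A / s) = ∑ _i ∈ hfin.toFinset, A / s := by
          rw [Finset.sum_const, nsmul_eq_mul]
      _ ≤ ∑ i ∈ hfin.toFinset, B i ^ p :=
          Finset.sum_le_sum fun i hi => not_lt.1 (hfin.mem_toFinset.1 hi)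
      _ ≤ ∑' i, B i ^ p := hsum.sum_le_tsum _ fun i _ => Real.rpow_nonneg (hB i) _
      _ ≤ A := hA
  have hcard : hfin.toFinset.card ≤ s := by
    rw [mul_div_assoc', div_le_iff₀ hs0, mul_comm] at hlarge
    exact_mod_cast le_of_mul_le_mul_left hlarge hA0
  obtain ⟨S, hS, hSs⟩ := Infinite.exists_superset_card_eq hfin.toFinset s hcard
  refine ⟨S, hSs, fun i hi => ?_⟩
  rw [one_div, Real.le_rpow_inv_iff_of_pos (hB i) (by positivity) hp]
  exact (not_not.1 fun h => hi (hS (hfin.mem_toFinset.2 h))).le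

lemma enorm_rpow_le_ofReal_mul (hp : 0 < p) (hpq : p ≤ q) {v : V} {x : ℝ} (hx : ‖v‖ ≤ x)
    (hτ : ‖v‖ ≤ τ) : ‖v‖ₑ ^ q ≤ ENNReal.ofReal (x ^ p * τ ^ (q - p)) := by
  rw [← ofReal_norm, ENNReal.ofReal_rpow_of_nonneg (norm_nonneg v) (hp.le.trans hpq)]
  refine ENNReal.ofReal_le_ofReal ?_
  have hx0 : 0 ≤ x := (norm_nonneg v).trans hx
  calc ‖v‖ ^ q = ‖v‖ ^ p * ‖v‖ ^ (q - p) := by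
        rw [← Real.rpow_add_of_nonneg (norm_nonneg v) hp.le (sub_nonneg.2 hpq), add_sub_cancel]
    _ ≤ x ^ p * τ ^ (q - p) := by gcongr

lemma ellNorm_le_of_norm_le (hp : 0 < p) (hpq : p ≤ q) (hsum : Summable fun i => B i ^ p)
    (hA : ∑' i, B i ^ p ≤ A) (hc : ∀ i, ‖c i‖ ≤ B i) (hτ0 : 0 ≤ τ) (hτ : ∀ i, ‖c i‖ ≤ τ) :
    ellNorm q c ≤ ENNReal.ofReal ((A * τ ^ (q - p)) ^ (1 / q)) := by
  have hq : 0 < q := hp.trans_le hpq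
  have hB (i : I) : 0 ≤ B i ^ p := Real.rpow_nonneg ((norm_nonneg _).trans (hc i)) p
  have hA0 : 0 ≤ A := (tsum_nonneg hB).trans hA
  rw [ellNorm, ← ENNReal.ofReal_rpow_of_nonneg (by positivity) (by positivity)]
  gcongr
  calc ∑' i, ‖c i‖ₑ ^ q
      ≤ ∑' i, ENNReal.ofReal (B i ^ p * τ ^ (q - p)) :=
        ENNReal.tsum_le_tsum fun i => enorm_rpow_le_ofReal_mul hp hpq (hc i) (hτ i)
    _ = ENNReal.ofReal ((∑' i, B i ^ p) * τ ^ (q - p)) := by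
        rw [← tsum_mul_right, ENNReal.ofReal_tsum_of_nonneg
          (fun i => mul_nonneg (hB i) (Real.rpow_nonneg hτ0 _)) (hsum.mul_right _)]
    _ ≤ ENNReal.ofReal (A * τ ^ (q - p)) := by gcongr

lemma mul_rpow_sub_rpow_one_div (hp : 0 < p) (hpq : p ≤ q) (hA : 0 < A) {x : ℝ} (hx : 0 < x) :
    (A * ((A / x) ^ (1 / p)) ^ (q - p)) ^ (1 / q) = A ^ (1 / p) * x ^ (1 / q - 1 / p) := by
  have hq : 0 < q := hp.trans_le hpq
  have hexp : 1 / p * ((q - p) * (1 / q)) = 1 / p - 1 / q := by field_simp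
  rw [Real.mul_rpow hA.le (by positivity), ← Real.rpow_mul (by positivity),
    ← Real.rpow_mul (by positivity), hexp, Real.div_rpow hA.le hx.le, ← mul_div_assoc,
    ← Real.rpow_add hA, add_sub_cancel, div_eq_mul_inv, ← Real.rpow_neg hx.le, neg_sub]

lemma norm_sub_restr_apply_le (c : I → V) (S : Finset I) (i : I) :
    ‖(c - restr c S) i‖ ≤ ‖c i‖ := by
  by_cases hi : i ∈ S <;> simp [restr, hi]

theorem ellNorm_sub_restr_le (hp : 0 < p) (hpq : p ≤ q) (hsum : Summable fun i => B i ^ p)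
    (hA0 : 0 < A) (hA : ∑' i, B i ^ p ≤ A) (hs : 1 ≤ s) {S : Finset I}
    (hS : ∀ i ∉ S, B i ≤ (A / s) ^ (1 / p)) (hc : ∀ i, ‖c i‖ ≤ B i) :
    ellNorm q (c - restr c S) ≤ ENNReal.ofReal (A ^ (1 / p) * (s : ℝ) ^ (1 / q - 1 / p)) := by
  have hτ : 0 ≤ (A / s) ^ (1 / p) := by positivity
  rw [← mul_rpow_sub_rpow_one_div hp hpq hA0 (by exact_mod_cast hs)]
  refine ellNorm_le_of_norm_le hp hpq hsum hA
    (fun i => (norm_sub_restr_apply_le c S i).trans (hc i)) hτ fun i => ?_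
  by_cases hi : i ∈ S
  · simpa [restr, hi] using hτ
  · exact (norm_sub_restr_apply_le c S i).trans ((hc i).trans (hS i hi))

lemma bestTermError_le (hq : 0 < q) (c : I → V) {S : Finset I} (hS : S.card ≤ s) :
    bestTermError s q c ≤ ellNorm q (c - restr c S) := by
  refine iInf₂_le (restr c S) ⟨?_, ?_⟩
  · have hzero : ∀ i ∉ S, ‖restr c S i‖ₑ ^ q = 0 := fun i hi => by simp [restr, hi, hq]
    rw [ellNorm, tsum_eq_sum hzero]
    exact ENNReal.rpow_lt_top_of_nonneg (by positivity) (ENNReal.sum_lt_top.2 fun i _ =>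
      ENNReal.rpow_lt_top_of_nonneg hq.le enorm_ne_top).ne
  · calc (Function.support (restr c S)).encard ≤ (S : Set I).encard :=
          Set.encard_le_encard Set.support_indicator_subset
      _ = S.card := Set.encard_coe_eq_coe_finsetCard S
      _ ≤ s := by exact_mod_cast hS

end Stechkin

/-! ### Orthonormality and completeness of the tensor product Legendre polynomials -/

section Orthonormality

lemma integral_prod_infinitePi {ι X : Type*} [MeasurableSpace X] (μ : Measure X)
    [IsProbabilityMeasure μ] (s : Finset ι) {g : ι → X → ℝ}
    (hg : ∀ i, AEStronglyMeasurable (g i) μ) :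
    ∫ y : ι → X, ∏ i ∈ s, g i (y i) ∂Measure.infinitePi (fun _ => μ) =
      ∏ i ∈ s, ∫ x, g i x ∂μ := by
  have hmeas : AEStronglyMeasurable (fun x : s → X => ∏ i : s, g i (x i))
      (Measure.pi fun _ => μ) :=
    Finset.aestronglyMeasurable_fun_prod _ fun i _ =>
      (hg i).comp_quasiMeasurePreserving (Measure.quasiMeasurePreserving_eval _ i)
  calc ∫ y : ι → X, ∏ i ∈ s, g i (y i) ∂Measure.infinitePi (fun _ => μ)
      = ∫ y : ι → X, ∏ i : s, g i (s.restrict y i) ∂Measure.infinitePi (fun _ => μ) :=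
        integral_congr_ae (ae_of_all _ fun y =>
          (Finset.prod_coe_sort s fun i => g i (y i)).symm)
    _ = ∫ x : s → X, ∏ i : s, g i (x i) ∂Measure.pi (fun _ => μ) :=
        integral_restrict_infinitePi (μ := fun _ => μ) hmeas
    _ = ∏ i : s, ∫ x, g i x ∂μ := integral_fintype_prod_eq_prod (𝕜 := ℝ) fun (i : s) => g i
    _ = ∏ i ∈ s, ∫ x, g i x ∂μ := Finset.prod_coe_sort s fun i => ∫ x, g i x ∂μ

theorem integral_Psi_mul_Psi (ν μ : ℕ →₀ ℕ) :
    ∫ y, Psi ν y * Psi μ y ∂unifDom = if ν = μ then 1 else 0 := by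
  have hcont (i : ℕ) : Continuous fun t : Set.Icc (-1 : ℝ) 1 => psi (ν i) t * psi (μ i) t := by
    fun_prop
  have hprod : ∫ y, Psi ν y * Psi μ y ∂unifDom =
      ∏ i ∈ ν.support ∪ μ.support, if ν i = μ i then 1 else 0 := by
    have hν : ν.support ⊆ ν.support ∪ μ.support := Finset.subset_union_left
    have hμ : μ.support ⊆ ν.support ∪ μ.support := Finset.subset_union_right
    simp only [Psi_eq_prod hν, Psi_eq_prod hμ, ← Finset.prod_mul_distrib, ← integral_psi_mul_psi]
    exact integral_prod_infinitePi unif _ fun i => (hcont i).aestronglyMeasurable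
  rw [hprod, Finset.prod_ite_zero, Finset.prod_const_one]
  refine if_congr ⟨fun h => Finsupp.ext fun i => ?_, fun h i _ => DFunLike.congr_fun h i⟩ rfl rfl
  by_cases hi : i ∈ ν.support ∪ μ.support
  · exact h i hi
  · simp_all

end Orthonormality

section Density

/-- The tensor product Legendre polynomial `Ψ_ν` as an element of the algebra of continuous
functions, to which the Stone–Weierstrass theorem applies. -/
def PsiMap (ν : ℕ →₀ ℕ) : C(Dom, ℝ) := ⟨Psi ν, continuous_Psi ν⟩

/-- The coordinate function `y ↦ y_j` as an element of the algebra of continuous functions. -/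
def coordMap (j : ℕ) : C(Dom, ℝ) := ⟨fun y => y j, by fun_prop⟩

lemma Psi_update (ν : ℕ →₀ ℕ) (j k : ℕ) (y : Dom) :
    Psi (ν.update j k) y = psi k (y j) * ∏ i ∈ ν.support.erase j, psi (ν i) (y i) := by
  classical
  have hsupp : (ν.update j k).support ⊆ insert j (ν.support.erase j) := by
    intro i hi
    by_cases hij : i = j
    · simp [hij]
    · simpa [hij] using hi
  rw [Psi_eq_prod hsupp, Finset.prod_insert (Finset.notMem_erase j _)]
  congr 1
  · simp
  · exact Finset.prod_congr rfl fun i hi => by simp [Finset.ne_of_mem_erase hi]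

lemma coordMap_mul_PsiMap_mem_span (j : ℕ) (ν : ℕ →₀ ℕ) :
    coordMap j * PsiMap ν ∈ Submodule.span ℝ (Set.range PsiMap) := by
  obtain ⟨N, a, ha⟩ := exists_eval_eq_sum_psi
    (Polynomial.X * (Polynomial.C √(2 * (ν j : ℝ) + 1) * legendreP (ν j)))
  have hmul (t : ℝ) : t * psi (ν j) t = ∑ k ∈ N, a k * psi k t := by
    simpa only [psi, Polynomial.eval_mul, Polynomial.eval_X, Polynomial.eval_C] using ha t
  have hsum : coordMap j * PsiMap ν = ∑ k ∈ N, a k • PsiMap (ν.update j k) := by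
    ext y
    have hν : Psi ν y = psi (ν j) (y j) * ∏ i ∈ ν.support.erase j, psi (ν i) (y i) := by
      rw [← Psi_update, Finsupp.update_self]
    simp only [coordMap, PsiMap, ContinuousMap.mul_apply, ContinuousMap.coe_mk,
      ContinuousMap.sum_apply, ContinuousMap.smul_apply, smul_eq_mul, Psi_update, hν,
      ← mul_assoc, ← Finset.sum_mul, hmul]
  rw [hsum]
  exact Submodule.sum_mem _ fun k _ =>
    Submodule.smul_mem _ _ (Submodule.subset_span (Set.mem_range_self _))

lemma coordMap_mul_mem_span (j : ℕ) {g : C(Dom, ℝ)}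
    (hg : g ∈ Submodule.span ℝ (Set.range PsiMap)) :
    coordMap j * g ∈ Submodule.span ℝ (Set.range PsiMap) := by
  induction hg using Submodule.span_induction with
  | mem _ h => obtain ⟨ν, rfl⟩ := h; exact coordMap_mul_PsiMap_mem_span j ν
  | zero => simp
  | add _ _ _ _ h₁ h₂ => rw [mul_add]; exact Submodule.add_mem _ h₁ h₂
  | smul a _ _ h => rw [mul_smul_comm]; exact Submodule.smul_mem _ _ h

lemma mul_mem_span_of_mem_adjoin_coordMap {h g : C(Dom, ℝ)}
    (hh : h ∈ Algebra.adjoin ℝ (Set.range coordMap))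
    (hg : g ∈ Submodule.span ℝ (Set.range PsiMap)) :
    h * g ∈ Submodule.span ℝ (Set.range PsiMap) := by
  induction hh using Algebra.adjoin_induction generalizing g with
  | mem _ h => obtain ⟨j, rfl⟩ := h; exact coordMap_mul_mem_span j hg
  | algebraMap r => rw [← Algebra.smul_def]; exact Submodule.smul_mem _ _ hg
  | add _ _ _ _ h₁ h₂ => rw [add_mul]; exact Submodule.add_mem _ (h₁ hg) (h₂ hg)
  | mul _ _ _ _ h₁ h₂ => rw [mul_assoc]; exact h₁ (h₂ hg)

theorem dense_span_PsiMap : Dense (Submodule.span ℝ (Set.range PsiMap) : Set C(Dom, ℝ)) := by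
  have hsep : (Algebra.adjoin ℝ (Set.range coordMap)).SeparatesPoints := by
    intro x y hxy
    obtain ⟨j, hj⟩ := Function.ne_iff.1 hxy
    exact ⟨coordMap j, ⟨coordMap j, Algebra.subset_adjoin ⟨j, rfl⟩, rfl⟩,
      fun h => hj (Subtype.ext h)⟩
  have hdense : Dense (Algebra.adjoin ℝ (Set.range coordMap) : Set C(Dom, ℝ)) := by
    rw [dense_iff_closure_eq, ← Subalgebra.topologicalClosure_coe,
      ContinuousMap.subalgebra_topologicalClosure_eq_top_of_separatesPoints _ hsep,
      Algebra.coe_top]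
  have hone : (1 : C(Dom, ℝ)) ∈ Submodule.span ℝ (Set.range PsiMap) :=
    Submodule.subset_span ⟨0, ContinuousMap.ext fun y => by simp [PsiMap, Psi]⟩
  refine hdense.mono fun h hh => ?_
  simpa only [mul_one, SetLike.mem_coe] using mul_mem_span_of_mem_adjoin_coordMap hh hone

lemma dense_toLp_span_PsiMap :
    Dense (ContinuousMap.toLp (E := ℝ) 2 unifDom ℝ ''
      (Submodule.span ℝ (Set.range PsiMap) : Set C(Dom, ℝ))) :=
  (ContinuousMap.toLp_denseRange ℝ unifDom ℝ (by norm_num)).dense_image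
    (ContinuousMap.toLp 2 unifDom ℝ).continuous dense_span_PsiMap

end Density

section Completeness

variable {V : Type*} [NormedAddCommGroup V] [NormedSpace ℝ V] [CompleteSpace V] {f : Dom → V}

lemma integral_Lp_smul_eq_zero (hf : MemLp f 2 unifDom) (h : ∀ ν, coeff f ν = 0)
    (φ : Lp ℝ 2 unifDom) : ∫ y, φ y • f y ∂unifDom = 0 := by
  let T : Lp ℝ 2 unifDom →L[ℝ] V :=
    ((ContinuousLinearMap.lsmul ℝ ℝ).lpPairing unifDom 2 2).flip (hf.toLp f)
  have hT (φ : Lp ℝ 2 unifDom) : T φ = ∫ y, φ y • f y ∂unifDom := by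
    refine ((ContinuousLinearMap.lsmul ℝ ℝ).lpPairing_eq_integral φ (hf.toLp f)).trans
      (integral_congr_ae ?_)
    filter_upwards [hf.coeFn_toLp] with y hy
    rw [hy, ContinuousLinearMap.lsmul_apply]
  have hspan : Submodule.span ℝ (Set.range PsiMap) ≤
      LinearMap.ker (T ∘L ContinuousMap.toLp 2 unifDom ℝ).toLinearMap := by
    refine Submodule.span_le.2 ?_
    rintro _ ⟨ν, rfl⟩
    refine (hT (ContinuousMap.toLp 2 unifDom ℝ (PsiMap ν))).trans
      (Eq.trans (integral_congr_ae ?_) (h ν))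
    filter_upwards [ContinuousMap.coeFn_toLp (p := 2) (𝕜 := ℝ) unifDom (PsiMap ν)] with y hy
    rw [hy, PsiMap, ContinuousMap.coe_mk]
  have hzero : T = 0 := ContinuousLinearMap.coeFn_injective <|
    T.continuous.ext_on dense_toLp_span_PsiMap continuous_zero <| by
      rintro _ ⟨g, hg, rfl⟩
      exact hspan hg
  rw [← hT, hzero, zero_apply]

theorem ae_eq_zero_of_coeff_eq_zero (hf : MemLp f 2 unifDom) (h : ∀ ν, coeff f ν = 0) :
    f =ᵐ[unifDom] 0 := by
  refine (hf.integrable (by norm_num)).ae_eq_zero_of_forall_setIntegral_eq_zero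
    fun s hs hsμ => ?_
  rw [← integral_Lp_smul_eq_zero hf h (indicatorConstLp 2 hs hsμ.ne 1), ← integral_indicator hs]
  refine integral_congr_ae ?_
  filter_upwards [indicatorConstLp_coeFn (p := 2) (hs := hs) (hμs := hsμ.ne) (c := (1 : ℝ))]
    with y hy
  rw [hy]
  by_cases hys : y ∈ s <;> simp [hys]

end Completeness

/-! ### Parseval's identity -/

section PartialSum

variable {V : Type*} [NormedAddCommGroup V] [NormedSpace ℝ V] {f : Dom → V}

lemma coeff_congr_ae {g : Dom → V} (h : f =ᵐ[unifDom] g) : coeff f = coeff g :=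
  funext fun _ => integral_congr_ae (h.mono fun _ hy => congrArg (_ • ·) hy)

lemma memLp_Psi_smul_const (ν : ℕ →₀ ℕ) (v : V) (p : ℝ≥0∞) :
    MemLp (fun y => Psi ν y • v) p unifDom := by
  have hcont : Continuous fun y => Psi ν y • v := by fun_prop
  exact hcont.memLp_of_hasCompactSupport (HasCompactSupport.of_compactSpace _)

lemma memLp_partialSum (f : Dom → V) (S : Finset (ℕ →₀ ℕ)) (p : ℝ≥0∞) :
    MemLp (partialSum f S) p unifDom :=
  memLp_finsetSum S fun ν _ => memLp_Psi_smul_const ν (coeff f ν) p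

variable [CompleteSpace V]

lemma coeff_Psi_smul_const (μ ν : ℕ →₀ ℕ) (v : V) :
    coeff (fun y => Psi μ y • v) ν = if ν = μ then v else 0 := by
  simp only [coeff, smul_smul, integral_smul_const, integral_Psi_mul_Psi, ite_smul, one_smul,
    zero_smul]

lemma coeff_partialSum (f : Dom → V) (S : Finset (ℕ →₀ ℕ)) (ν : ℕ →₀ ℕ) :
    coeff (partialSum f S) ν = restr (coeff f) S ν := by
  have hint : ∀ μ ∈ S, Integrable (fun y => Psi ν y • Psi μ y • coeff f μ) unifDom :=
    fun μ _ => integrable_Psi_smul ν ((memLp_Psi_smul_const μ _ 1).integrable le_rfl)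
  calc coeff (partialSum f S) ν
      = ∑ μ ∈ S, coeff (fun y => Psi μ y • coeff f μ) ν := by
        simp only [coeff, partialSum, Finset.smul_sum]
        exact integral_finsetSum S hint
    _ = restr (coeff f) S ν := by
        simp only [coeff_Psi_smul_const, Finset.sum_ite_eq, restr, Set.indicator_apply,
          Finset.mem_coe]

lemma coeff_sub_partialSum (hf : Integrable f unifDom) (S : Finset (ℕ →₀ ℕ)) :
    coeff (fun y => f y - partialSum f S y) = coeff f - restr (coeff f) S := by
  ext ν
  have hS := (memLp_partialSum f S 1).integrable le_rfl
  rw [Pi.sub_apply, ← coeff_partialSum]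
  simp only [coeff, smul_sub]
  exact integral_sub (integrable_Psi_smul ν hf) (integrable_Psi_smul ν hS)

end PartialSum

lemma ofReal_norm_lp_eq_ellNorm {I V : Type*} [NormedAddCommGroup V] {p : ℝ≥0∞}
    (hp : 0 < p.toReal) (x : lp (fun _ : I => V) p) :
    ENNReal.ofReal ‖x‖ = ellNorm p.toReal x := by
  have hnn (i : I) : 0 ≤ ‖x i‖ ^ p.toReal := by positivity
  rw [lp.norm_eq_tsum_rpow hp, ← ENNReal.ofReal_rpow_of_nonneg (tsum_nonneg hnn) (by positivity),
    ENNReal.ofReal_tsum_of_nonneg hnn ((lp.memℓp x).summable hp), ellNorm]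
  simp only [← ENNReal.ofReal_rpow_of_nonneg (norm_nonneg _) hp.le, ofReal_norm]

section Parseval

open scoped RealInnerProductSpace

variable {V : Type*} [NormedAddCommGroup V] [InnerProductSpace ℝ V] [CompleteSpace V]

lemma inner_toLp_Psi_smul (ν : ℕ →₀ ℕ) (v : V) (F : Lp V 2 unifDom) :
    ⟪(memLp_Psi_smul_const ν v 2).toLp _, F⟫ = ⟪v, coeff F ν⟫ := by
  have hF : Integrable F unifDom := (Lp.memLp F).integrable (by norm_num)
  rw [L2.inner_def, coeff, ← integral_inner (integrable_Psi_smul ν hF)]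
  refine integral_congr_ae ?_
  filter_upwards [(memLp_Psi_smul_const ν v 2).coeFn_toLp] with y hy
  rw [hy, real_inner_smul_left, real_inner_smul_right]

lemma coeff_toLp_Psi_smul (μ ν : ℕ →₀ ℕ) (v : V) :
    coeff ((memLp_Psi_smul_const μ v 2).toLp _) ν = if ν = μ then v else 0 := by
  rw [coeff_congr_ae (memLp_Psi_smul_const μ v 2).coeFn_toLp, coeff_Psi_smul_const]

variable (V) in
/-- The embedding `v ↦ Ψ_ν v` of the coefficient space as the `ν`-th summand of `L²(U; V)`. -/
def PsiIsometry (ν : ℕ →₀ ℕ) : V →ₗᵢ[ℝ] Lp V 2 unifDom :=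
  LinearMap.isometryOfInner
    { toFun := fun v => (memLp_Psi_smul_const ν v 2).toLp _
      map_add' := fun v w => by
        rw [← MemLp.toLp_add]
        exact MemLp.toLp_congr _ _ (ae_of_all _ fun y => smul_add (Psi ν y) v w)
      map_smul' := fun a v => by
        rw [← MemLp.toLp_const_smul]
        exact MemLp.toLp_congr _ _ (ae_of_all _ fun y => smul_comm (Psi ν y) a v) }
    fun v w => (inner_toLp_Psi_smul ν v _).trans <|
      congrArg (inner ℝ v) ((coeff_toLp_Psi_smul ν ν w).trans (if_pos rfl))

lemma inner_PsiIsometry (ν : ℕ →₀ ℕ) (v : V) (F : Lp V 2 unifDom) :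
    ⟪PsiIsometry V ν v, F⟫ = ⟪v, coeff F ν⟫ :=
  inner_toLp_Psi_smul ν v F

lemma coeff_PsiIsometry (μ ν : ℕ →₀ ℕ) (v : V) :
    coeff (PsiIsometry V μ v) ν = if ν = μ then v else 0 :=
  coeff_toLp_Psi_smul μ ν v

variable (V) in
theorem isHilbertSum_PsiIsometry :
    IsHilbertSum ℝ (fun _ : ℕ →₀ ℕ => V) (PsiIsometry V) := by
  refine .mk (fun ν μ h v w => ?_) (top_le_iff.2 ?_)
  · rw [inner_PsiIsometry, coeff_PsiIsometry, if_neg h, inner_zero_right]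
  · rw [Submodule.topologicalClosure_eq_top_iff, Submodule.eq_bot_iff]
    intro F hF
    refine Lp.ext ((ae_eq_zero_of_coeff_eq_zero (Lp.memLp F) fun ν => ?_).trans
      (Lp.coeFn_zero V 2 unifDom).symm)
    refine ext_inner_left ℝ fun v => ?_
    rw [← inner_PsiIsometry, inner_zero_right]
    exact hF _ (Submodule.mem_iSup_of_mem ν ⟨v, rfl⟩)

lemma isHilbertSum_PsiIsometry_apply (F : Lp V 2 unifDom) :
    ⇑((isHilbertSum_PsiIsometry V).linearIsometryEquiv F) = coeff F := by
  classical
  ext ν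
  refine ext_inner_left ℝ fun v => ?_
  let Φ := (isHilbertSum_PsiIsometry V).linearIsometryEquiv
  calc ⟪v, Φ F ν⟫ = ⟪lp.single 2 ν v, Φ F⟫ := (lp.inner_single_left ν v (Φ F)).symm
    _ = ⟪Φ.symm (lp.single 2 ν v), F⟫ := (Φ.symm.inner_map_eq_flip _ F).symm
    _ = ⟪PsiIsometry V ν v, F⟫ := by
        rw [IsHilbertSum.linearIsometryEquiv_symm_apply_single]
    _ = ⟪v, coeff F ν⟫ := inner_PsiIsometry ν v F

theorem eLpNorm_eq_ellNorm_coeff {f : Dom → V} (hf : MemLp f 2 unifDom) :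
    eLpNorm f 2 unifDom = ellNorm 2 (coeff f) := by
  rw [← Lp.enorm_toLp hf, ← ofReal_norm,
    ← (isHilbertSum_PsiIsometry V).linearIsometryEquiv.norm_map,
    ofReal_norm_lp_eq_ellNorm (by norm_num), isHilbertSum_PsiIsometry_apply,
    coeff_congr_ae hf.coeFn_toLp, ENNReal.toReal_ofNat]

theorem eLpNorm_sub_partialSum {f : Dom → V} (hf : MemLp f 2 unifDom) (S : Finset (ℕ →₀ ℕ)) :
    eLpNorm (fun y => f y - partialSum f S y) 2 unifDom =
      ellNorm 2 (coeff f - restr (coeff f) S) := by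
  rw [← coeff_sub_partialSum (hf.integrable (by norm_num))]
  exact eLpNorm_eq_ellNorm_coeff (hf.sub (memLp_partialSum f S 2))

end Parseval

theorem IsPolyellipseMajorant.norm_coeff_le {V W : Type*} [NormedAddCommGroup V]
    [NormedSpace ℝ V] [CompleteSpace V] [NormedAddCommGroup W] [NormedSpace ℂ W]
    [CompleteSpace W] {ι : V →ₗᵢ[ℝ] W} {b : ℕ → ℝ} {B : (ℕ →₀ ℕ) → ℝ} {f : Dom → V}
    (hB : IsPolyellipseMajorant b B) (hf : f ∈ holoClass ι b)
    (hm : AEStronglyMeasurable f unifDom) (ν : ℕ →₀ ℕ) : ‖coeff f ν‖ ≤ B ν := by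
  obtain ⟨ρ, hρ, hsum, hle, hprod⟩ := hB ν
  exact (HoloApprox.norm_coeff_le hf hm ν (fun j => (hρ j).le) (fun j _ => hρ j) hsum hle).trans
    hprod

end

end HoloApprox

open HoloApprox in
theorem theoremt_general (b : ℕ → ℝ) (hb : ∀ j, 0 ≤ b j) (p : ℝ) (hp0 : 0 < p) (hp1 : p ≤ 1)
    (hbp : Memℓp b (ENNReal.ofReal p)) :
    ∃ C : ℝ, 0 < C ∧ ∀ s : ℕ, 1 ≤ s → ∃ S : Finset (ℕ →₀ ℕ), S.card = s ∧
      (∀ (V : Type*) [NormedAddCommGroup V] [NormedSpace ℝ V] [CompleteSpace V]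
        (W : Type*) [NormedAddCommGroup W] [NormedSpace ℂ W] [CompleteSpace W]
        (ι : V →ₗᵢ[ℝ] W) (f : Dom → V), f ∈ holoClass ι b → AEStronglyMeasurable f unifDom →
        ∀ q : ℝ, p ≤ q →
          bestTermError s q (coeff f) ≤ ellNorm q (coeff f - restr (coeff f) S) ∧
          ellNorm q (coeff f - restr (coeff f) S) ≤
            ENNReal.ofReal (C * (s : ℝ) ^ (1 / q - 1 / p))) ∧
      ∀ (V : Type*) [NormedAddCommGroup V] [InnerProductSpace ℝ V] [CompleteSpace V]
        (W : Type*) [NormedAddCommGroup W] [NormedSpace ℂ W] [CompleteSpace W]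
        (ι : V →ₗᵢ[ℝ] W) (f : Dom → V), f ∈ holoClass ι b → AEStronglyMeasurable f unifDom →
        bestL2Error s f ≤ eLpNorm (fun y => f y - partialSum f S y) 2 unifDom ∧
        eLpNorm (fun y => f y - partialSum f S y) 2 unifDom ≤
          ENNReal.ofReal (C * (s : ℝ) ^ (1 / 2 - 1 / p)) := by
  obtain ⟨B, hB0, hBp, hB⟩ := exists_isPolyellipseMajorant hb hp0 hp1 hbp
  have hA0 : 0 < 1 + ∑' ν, B ν ^ p :=
    add_pos_of_pos_of_nonneg one_pos (tsum_nonneg fun ν => Real.rpow_nonneg (hB0 ν) p)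
  have hA : ∑' ν, B ν ^ p ≤ 1 + ∑' ν, B ν ^ p := le_add_of_nonneg_left zero_le_one
  refine ⟨(1 + ∑' ν, B ν ^ p) ^ (1 / p), by positivity, fun s hs => ?_⟩
  obtain ⟨S, hcard, hS⟩ := exists_finset_card_eq_forall_notMem_le hp0 hB0 hBp hA0 hA hs
  refine ⟨S, hcard, fun V _ _ _ W _ _ _ ι f hf hm q hpq => ⟨?_, ?_⟩,
    fun V _ _ _ W _ _ _ ι f hf hm => ⟨iInf₂_le S hcard, ?_⟩⟩
  · exact bestTermError_le (hp0.trans_le hpq) _ hcard.le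
  · exact ellNorm_sub_restr_le hp0 hpq hBp hA0 hA hs hS (hB.norm_coeff_le hf hm)
  · rw [eLpNorm_sub_partialSum (memLp_of_mem_holoClass hf hm 2)]
    exact ellNorm_sub_restr_le hp0 (by linarith) hBp hA0 hA hs hS (hB.norm_coeff_le hf hm)

theorem theoremt (b : ℕ → ℝ) (hb : ∀ j, 0 ≤ b j) (p : ℝ) (hp0 : 0 < p) (hp1 : p < 1)
    (hbp : Memℓp b (ENNReal.ofReal p)) :
    ∃ C : ℝ, 0 < C ∧
      (∀ (s : ℕ) (q : ℝ), 1 ≤ s → p ≤ q → q ≤ 2 →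
        ∃ S : Finset (ℕ →₀ ℕ), S.card ≤ s ∧
          ∀ (V : Type*) [NormedAddCommGroup V] [NormedSpace ℝ V] [CompleteSpace V]
            (W : Type*) [NormedAddCommGroup W] [NormedSpace ℂ W] [CompleteSpace W]
            (ι : V →ₗᵢ[ℝ] W) (f : HoloApprox.Dom → V),
            f ∈ HoloApprox.holoClass ι b → AEStronglyMeasurable f HoloApprox.unifDom →
            HoloApprox.bestTermError s q (HoloApprox.coeff f) ≤
                HoloApprox.ellNorm q
                  (HoloApprox.coeff f - HoloApprox.restr (HoloApprox.coeff f) S) ∧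
              HoloApprox.ellNorm q
                  (HoloApprox.coeff f - HoloApprox.restr (HoloApprox.coeff f) S) ≤
                ENNReal.ofReal (C * (s : ℝ) ^ (1 / q - 1 / p))) ∧
      (∀ s : ℕ, 1 ≤ s →
        ∃ S : Finset (ℕ →₀ ℕ), S.card ≤ s ∧
          ∀ (V : Type*) [NormedAddCommGroup V] [InnerProductSpace ℝ V] [CompleteSpace V]
            (W : Type*) [NormedAddCommGroup W] [NormedSpace ℂ W] [CompleteSpace W]
            (ι : V →ₗᵢ[ℝ] W) (f : HoloApprox.Dom → V),
            f ∈ HoloApprox.holoClass ι b → AEStronglyMeasurable f HoloApprox.unifDom →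
            HoloApprox.bestL2Error s f ≤
                eLpNorm (fun y => f y - HoloApprox.partialSum f S y) 2 HoloApprox.unifDom ∧
              eLpNorm (fun y => f y - HoloApprox.partialSum f S y) 2 HoloApprox.unifDom ≤
                ENNReal.ofReal (C * (s : ℝ) ^ (1 / 2 - 1 / p))) := by
  obtain ⟨C, hC, h⟩ := theoremt_general b hb p hp0 hp1.le hbp
  refine ⟨C, hC, fun s q hs hpq _ => ?_, fun s hs => ?_⟩
  · obtain ⟨S, hS, hseq, -⟩ := h s hs
    exact ⟨S, hS.le, fun V _ _ _ W _ _ _ ι f hf hm => hseq V W ι f hf hm q hpq⟩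
  · obtain ⟨S, hS, -, hL2⟩ := h s hs
    exact ⟨S, hS.le, hL2⟩
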